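/- Let $0<\alpha<2$ and let $E\subset\mathbb R^d$ be a Lebesgue measurable set with Lebesgue measure $0<|E|<\infty$. On a probability space let $\Gamma_1<\Gamma_2<\cdots$ be the arrival times of a Poisson process with rate $1$, i.e. $\Gamma_k=\sum_{j=1}^k\lambda_j$ with $\lambda_j$ i.i.d. standard exponential. Let $(V_k,\rho_k)_{k\ge1}$ be i.i.d. random vectors, independent of $(\Gamma_k)_{k\ge1}$, where $V_k$ is uniformly distributed on $E$ and, conditionally on $V_k$, $\rho_k$ takes the values $1$ and $-1$ with probability $1/2$ each. Then the following hold. (0) The improper integral $\int_0^\infty x^{-\alpha}\sin x\,dx:=\lim_{R\to\infty}\int_0^R x^{-\alpha}\sin x\,dx$ exists and is positive. Put $C_\alpha=\left(\int_0^\infty x^{-\alpha}\sin x\,dx\right)^{-1}$. (1) For every (relatively) Borel set $A\subset E$ the series $$M(A):=(C_\alpha|E|)^{1/\alpha}\sum_{k=1}^\infty\rho_k\,\Gamma_k^{-1/\alpha}\,1_A(V_k)$$ converges almost surely. (2) $M$ is a symmetric $\alpha$-stable random measure on $E$ with Lebesgue measure as control measure. That is: for each such $A$, $M(A)$ is a random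 variable with law $S_\alpha(|A|^{1/\alpha},0,0)$, i.e. $\mathbb E\,e^{itM(A)}=\exp(-|A|\,|t|^\alpha)$ for all $t\in\mathbb R$; for pairwise disjoint $A_1,\dots,A_n$ the random variables $M(A_1),\dots,M(A_n)$ are independent; and for pairwise disjoint $A_1,A_2,\dots$ one has $M\big(\bigcup_jA_j\big)=\sum_{j=1}^\infty M(A_j)$ almost surely (convergence of partial sums). (3) Let $f\in L^p(E)$ be real-valued, where $1\le p\le\infty$ if $0<\alpha<1$, and $\alpha<p\le\infty$ if $1\le\alpha<2$. Then the series $$(C_\alpha|E|)^{1/\alpha}\sum_{k=1}^\infty\rho_k\,\Gamma_k^{-1/\alpha}f(V_k)$$ converges almost surely, and its sum is almost surely equal to the stochastic integral $\int_E f\,dM$. Here $\int_E g\,dM=\sum_i c_iM(A_i)$ for a simple function $g=\sum_i c_i1_{A_i}$, and, for $f\in L^\alpha(E)$, $\int_E f\,dM$ is the limit in probability of $\int_E g_k\,dM$ for every sequence of simple functions $g_k\to f$ in $L^\alpha(E)$ (in particular $f\in L^\alpha(E)$ here). -/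

import Mathlib

open MeasureTheory ProbabilityTheory Filter Topology
open scoped ENNReal NNReal

noncomputable section

/-! ### Stable laws on the real line -/

/-- The characteristic function of the stable law `S_α(σ, b, γ)`, where `α` is the stability
parameter, `σ` the scale, `b` the skewness and `γ` the shift. -/
def stableCharFun (α σ b γ t : ℝ) : ℂ :=
  if α = 1 then
    Complex.exp
      (-((σ * |t| : ℝ) : ℂ) *
          (1 + Complex.I * ((b * (2 / Real.pi) * Real.sign t * Real.log |t| : ℝ) : ℂ))
        + Complex.I * ((γ * t : ℝ) : ℂ))
  else
    Complex.exp
      (-((σ ^ α * |t| ^ α : ℝ) : ℂ) *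
          (1 - Complex.I * ((b * Real.sign t * Real.tan (Real.pi * α / 2) : ℝ) : ℂ))
        + Complex.I * ((γ * t : ℝ) : ℂ))

/-- The real random variable `X` has the stable law `S_α(σ, b, γ)`. -/
def HasStableLaw {Ω : Type*} [MeasurableSpace Ω] (X : Ω → ℝ) (α σ b γ : ℝ)
    (P : Measure Ω) : Prop :=
  AEMeasurable X P ∧ ∀ t : ℝ, charFun (P.map X) t = stableCharFun α σ b γ t

/-! ### Stable random measures and their integrals -/

/-- `M` is an `α`-stable random measure on the measurable sets of finite `m`-measure, with control
measure `m` and skewness function `β`: it is independently scattered, `σ`-additive, and `M A` has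
the law `S_α(m(A)^{1/α}, (∫_A β dm) / m(A), 0)`. Only the values of `M` on measurable sets of finite
`m`-measure matter. If `m(A) = 0` then the scale is `0` and the value of the skewness is
irrelevant. -/
structure IsStableRandomMeasure {X Ω : Type*} [MeasurableSpace X] [MeasurableSpace Ω]
    (α : ℝ) (β : X → ℝ) (m : Measure X) (P : Measure Ω) (M : Set X → Ω → ℝ) : Prop where
  measurable_skewness : Measurable β
  abs_skewness_le : ∀ x, |β x| ≤ 1
  hasStableLaw : ∀ A : Set X, MeasurableSet A → m A < ∞ →
    HasStableLaw (M A) α (m.real A ^ (1 / α)) ((∫ x in A, β x ∂m) / m.real A) 0 P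
  independentlyScattered : ∀ (n : ℕ) (A : Fin n → Set X),
    (∀ i, MeasurableSet (A i)) → (∀ i, m (A i) < ∞) → Pairwise (Function.onFun Disjoint A) →
      iIndepFun (fun i => M (A i)) P
  sigmaAdditive : ∀ A : ℕ → Set X,
    (∀ j, MeasurableSet (A j)) → m (⋃ j, A j) < ∞ → Pairwise (Function.onFun Disjoint A) →
      ∀ᵐ ω ∂P, Tendsto (fun n => ∑ j ∈ Finset.range n, M (A j) ω) atTop (𝓝 (M (⋃ j, A j) ω))

/-- A symmetric `α`-stable random measure: the skewness vanishes. -/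
def IsSymmetricStableRandomMeasure {X Ω : Type*} [MeasurableSpace X] [MeasurableSpace Ω]
    (α : ℝ) (m : Measure X) (P : Measure Ω) (M : Set X → Ω → ℝ) : Prop :=
  IsStableRandomMeasure α (fun _ => 0) m P M

/-- The integral `∑ y, y * M {g = y}` of a simple function `g` against the set function `M`. -/
def simpleStochasticIntegral {X Ω : Type*} [MeasurableSpace X] (M : Set X → Ω → ℝ)
    (g : SimpleFunc X ℝ) (ω : Ω) : ℝ :=
  ∑ y ∈ g.range, y * M (g ⁻¹' {y}) ω

/-- `J` is (a version of) the stochastic integral `∫ f dM` of `f ∈ L^α(m)`: it is the limit in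
probability of `∫ g_k dM` for every sequence of simple functions `g_k`, supported on sets of finite
measure, with `g_k → f` in `L^α(m)`. Such sequences exist since `0 < α < ∞`, so `J` is determined
up to almost sure equality. -/
structure IsStochasticIntegral {X Ω : Type*} [MeasurableSpace X] [MeasurableSpace Ω]
    (α : ℝ) (m : Measure X) (P : Measure Ω) (M : Set X → Ω → ℝ) (f : X → ℝ) (J : Ω → ℝ) :
    Prop where
  memLp : MemLp f (ENNReal.ofReal α) m
  aemeasurable : AEMeasurable J P
  tendstoInMeasure : ∀ g : ℕ → SimpleFunc X ℝ, (∀ k, (g k).FinMeasSupp m) →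
    Tendsto (fun k => eLpNorm (fun x => g k x - f x) (ENNReal.ofReal α) m) atTop (𝓝 0) →
      TendstoInMeasure P (fun k => simpleStochasticIntegral M (g k)) atTop J

/-! ### The series representation -/

/-- `Γ 0, Γ 1, …` are the successive arrival times of a Poisson process with rate `1`, that is,
the partial sums of i.i.d. standard exponential waiting times. -/
def IsPoissonArrivalTimes {Ω : Type*} [MeasurableSpace Ω] (Γ : ℕ → Ω → ℝ) (P : Measure Ω) :
    Prop :=
  ∃ τ : ℕ → Ω → ℝ, iIndepFun τ P ∧ (∀ j, HasLaw (τ j) (expMeasure 1) P) ∧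
    ∀ k, ∀ᵐ ω ∂P, Γ k ω = ∑ j ∈ Finset.range (k + 1), τ j ω

/-- The law of a fair sign: `1` and `-1` have probability `1/2` each. -/
def fairSign : Measure ℝ :=
  (2⁻¹ : ℝ≥0∞) • Measure.dirac 1 + (2⁻¹ : ℝ≥0∞) • Measure.dirac (-1)

/-- `∫ x in 0..R, x^{-α} sin x`, whose limit as `R → ∞` is the improper integral over `(0, ∞)`. -/
def sineIntegral (α R : ℝ) : ℝ :=
  ∫ x in (0 : ℝ)..R, x ^ (-α) * Real.sin x

/-- `C_α = (∫_0^∞ x^{-α} sin x dx)⁻¹`; the integral is an improper one, as it does not converge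
absolutely for `α ≤ 1`. -/
def stableConst (α : ℝ) : ℝ :=
  (limUnder atTop (sineIntegral α))⁻¹

/-- The sum of the first `n` terms of the series
`(C_α v)^{1/α} ∑ ρ_k Γ_k^{-1/α} g(V_k)`. -/
def seriesPartialSum {X Ω : Type*} (α v : ℝ) (Γ : ℕ → Ω → ℝ) (V : ℕ → Ω → X) (ρ : ℕ → Ω → ℝ)
    (g : X → ℝ) (n : ℕ) (ω : Ω) : ℝ :=
  (stableConst α * v) ^ (1 / α) *
    ∑ k ∈ Finset.range n, ρ k ω * Γ k ω ^ (-(1 / α)) * g (V k ω)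

/-- The sum of the series `(C_α v)^{1/α} ∑ ρ_k Γ_k^{-1/α} g(V_k)`, where it converges. -/
def seriesSum {X Ω : Type*} (α v : ℝ) (Γ : ℕ → Ω → ℝ) (V : ℕ → Ω → X) (ρ : ℕ → Ω → ℝ)
    (g : X → ℝ) (ω : Ω) : ℝ :=
  limUnder atTop fun n => seriesPartialSum α v Γ V ρ g n ω

/-- The set function `M(A) = (C_α v)^{1/α} ∑ ρ_k Γ_k^{-1/α} 1_A(V_k)` on subsets `A` of `E`. -/
def seriesMeasure {X Ω : Type*} (α v : ℝ) (Γ : ℕ → Ω → ℝ) (V : ℕ → Ω → X) (ρ : ℕ → Ω → ℝ)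
    (E : Set X) (A : Set E) : Ω → ℝ :=
  seriesSum α v Γ V ρ ((Subtype.val '' A).indicator fun _ => 1)

end

/-! Freeze the arrival times. The series then has independent symmetric terms `ρ_k a_k f(V_k)` with
constants `a_k = Γ_k^{-1/α}`. Since `Γ_k` grows at least linearly, `∑ |a_k|^p` is finite for every
`p > α`, and the three-series criterion gives convergence for `f ∈ L^p` with `α < p ≤ 2`
(`ae_exists_tendsto_signedSum`, `IsSignedMarkedPoisson.ae_exists_tendsto`).

For the law, averaging over marks and signs turns the characteristic function of a partial sum into
`E ∏ G(Γ_k)`, where `G` is the real function `cosTransform`. A martingale argument for the Poisson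
process shows that these expectations tend to `exp(-∫_0^∞ (1 - G))`
(`tendsto_integral_prod_arrivalTime`). The substitution `y = x^{-α}` evaluates the integral as
`|u|^α ∫|f|^α dν` times `stableIntegral α`, which is `∫_0^∞ x^{-α} sin x dx` by an integration by
parts. So the normalisation by `C_α |E|` leaves exactly `exp(-|t|^α ∫_E |f|^α)`
(`hasSymmetricStableCharFun_seriesSum`).

The rest follows from this formula and linearity of the series in `f`. Finite combinations of the
`M(A_i)` are again series, so their joint characteristic function factorises over disjoint sets. A
remainder whose `∫|f|^α` tends to `0` tends to `0` in probability; this identifies the limit both in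
σ-additivity and in the stochastic integral. -/

noncomputable section

/-! ### The sine integral and the constant `C_α` -/

/-- The density `α x^{-α-1} (1 - cos x)`, whose integral over `(0, ∞)` is `C_α⁻¹`. -/
def stableKernel (α x : ℝ) : ℝ := α * x ^ (-α - 1) * (1 - Real.cos x)

theorem stableKernel_nonneg {α x : ℝ} (hα : 0 ≤ α) (hx : 0 ≤ x) : 0 ≤ stableKernel α x :=
  mul_nonneg (mul_nonneg hα (Real.rpow_nonneg hx _)) (by linarith [Real.cos_le_one x])

theorem measurable_stableKernel (α : ℝ) : Measurable (stableKernel α) := by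
  unfold stableKernel
  fun_prop

theorem one_sub_cos_le_sq (x : ℝ) : 1 - Real.cos x ≤ x ^ 2 := by
  nlinarith [Real.one_sub_sq_div_two_le_cos (x := x), sq_nonneg x]

theorem rpow_neg_sub_one_mul_sq {α x : ℝ} (hx : 0 < x) :
    x ^ (-α - 1) * x ^ 2 = x ^ (1 - α) := by
  rw [← Real.rpow_natCast, ← Real.rpow_add hx]
  congr 1
  push_cast
  ring

/-- Near `0` the bound `1 - cos x ≤ x²` leaves `x^{1-α}`, integrable because `α < 2`; near infinity
`x^{-α-1}` is integrable because `α > 0`. -/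
theorem integrableOn_stableKernel {α : ℝ} (hα0 : 0 < α) (hα2 : α < 2) :
    IntegrableOn (stableKernel α) (Set.Ioi 0) := by
  rw [← Set.Ioc_union_Ioi_eq_Ioi zero_le_one]
  refine IntegrableOn.union ?_ ?_
  · have h : IntegrableOn (fun x : ℝ => α * x ^ (1 - α)) (Set.Ioc 0 1) :=
      (((intervalIntegral.intervalIntegrable_rpow' (by linarith)).1).const_mul α)
    refine h.mono' (measurable_stableKernel α).aestronglyMeasurable ?_
    filter_upwards [ae_restrict_mem measurableSet_Ioc] with x hx
    rw [Real.norm_of_nonneg (stableKernel_nonneg hα0.le hx.1.le), stableKernel,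
      ← rpow_neg_sub_one_mul_sq hx.1, ← mul_assoc]
    exact mul_le_mul_of_nonneg_left (one_sub_cos_le_sq x)
      (mul_nonneg hα0.le (Real.rpow_nonneg hx.1.le _))
  · have h : IntegrableOn (fun x : ℝ => α * x ^ (-α - 1) * 2) (Set.Ioi 1) :=
      ((integrableOn_Ioi_rpow_of_lt (by linarith) one_pos).const_mul α).mul_const 2
    refine h.mono' (measurable_stableKernel α).aestronglyMeasurable ?_
    filter_upwards [ae_restrict_mem measurableSet_Ioi] with x hx
    have hx0 : (0 : ℝ) ≤ x := zero_le_one.trans hx.le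
    rw [Real.norm_of_nonneg (stableKernel_nonneg hα0.le hx0), stableKernel]
    exact mul_le_mul_of_nonneg_left (by linarith [Real.neg_one_le_cos x])
      (mul_nonneg hα0.le (Real.rpow_nonneg hx0 _))

/-- The value of `∫_0^∞ x^{-α} sin x dx`, as an absolutely convergent integral. -/
def stableIntegral (α : ℝ) : ℝ := ∫ x in Set.Ioi (0 : ℝ), stableKernel α x

theorem stableIntegral_pos {α : ℝ} (hα0 : 0 < α) (hα2 : α < 2) : 0 < stableIntegral α := by
  have hnn : 0 ≤ᵐ[volume.restrict (Set.Ioi (0 : ℝ))] stableKernel α := by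
    filter_upwards [ae_restrict_mem measurableSet_Ioi] with x hx
    exact stableKernel_nonneg hα0.le hx.le
  refine (setIntegral_pos_iff_support_of_nonneg_ae hnn (integrableOn_stableKernel hα0 hα2)).2 ?_
  refine lt_of_lt_of_le ?_ (measure_mono (s := Set.Ioo (0 : ℝ) 1) ?_)
  · simp
  · intro x hx
    refine ⟨ne_of_gt (mul_pos (mul_pos hα0 (Real.rpow_pos_of_pos hx.1 _)) ?_), hx.1⟩
    have := Real.cos_lt_cos_of_nonneg_of_le_pi_div_two le_rfl
      (by linarith [Real.pi_gt_three, hx.2]) hx.1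
    rw [Real.cos_zero] at this
    linarith

/-- Integration by parts, with `1 - cos` rather than `-cos` as primitive of `sin`: the boundary term
at `0` then vanishes, being at most `x^{2-α}`. -/
theorem sineIntegral_eq {α : ℝ} (hα0 : 0 < α) (hα2 : α < 2) {R : ℝ} (hR : 0 < R) :
    sineIntegral α R =
      R ^ (-α) * (1 - Real.cos R) + ∫ x in (0 : ℝ)..R, stableKernel α x := by
  have hK : IntervalIntegrable (stableKernel α) volume 0 R := by
    rw [intervalIntegrable_iff_integrableOn_Ioc_of_le hR.le]
    exact (integrableOn_stableKernel hα0 hα2).mono_set Set.Ioc_subset_Ioi_self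
  have hS : IntervalIntegrable (fun x : ℝ => x ^ (-α) * Real.sin x) volume 0 R := by
    rw [intervalIntegrable_iff_integrableOn_Ioc_of_le hR.le]
    have h : IntegrableOn (fun x : ℝ => x ^ (1 - α)) (Set.Ioc 0 R) :=
      (intervalIntegral.intervalIntegrable_rpow' (by linarith)).1
    refine h.mono' (by fun_prop : Measurable _).aestronglyMeasurable ?_
    filter_upwards [ae_restrict_mem measurableSet_Ioc] with x hx
    rw [norm_mul, Real.norm_of_nonneg (Real.rpow_nonneg hx.1.le _), sub_eq_neg_add,
      Real.rpow_add_one hx.1.ne', Real.norm_eq_abs]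
    refine mul_le_mul_of_nonneg_left ?_ (Real.rpow_nonneg hx.1.le _)
    simpa [abs_of_pos hx.1] using Real.abs_sin_le_abs (x := x)
  have hderiv : ∀ x ∈ Set.Ioo 0 R, HasDerivAt (fun x : ℝ => x ^ (-α) * (1 - Real.cos x))
      (x ^ (-α) * Real.sin x - stableKernel α x) x := by
    intro x hx
    have h1 := Real.hasDerivAt_rpow_const (p := -α) (Or.inl hx.1.ne')
    have h2 := (Real.hasDerivAt_cos x).const_sub 1
    convert! h1.mul h2 using 1
    rw [stableKernel]
    ring
  have hcont : ContinuousOn (fun x : ℝ => x ^ (-α) * (1 - Real.cos x)) (Set.Icc 0 R) := by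
    intro x hx
    rcases hx.1.eq_or_lt with h0 | h0
    · subst h0
      have hb : Tendsto (fun x : ℝ => x ^ (2 - α)) (𝓝[Set.Icc 0 R] 0) (𝓝 0) := by
        have := (Real.continuousAt_rpow_const 0 (2 - α) (Or.inr (by linarith))).tendsto
        rw [Real.zero_rpow (by linarith)] at this
        exact this.mono_left nhdsWithin_le_nhds
      rw [ContinuousWithinAt, Real.cos_zero, sub_self, mul_zero]
      refine squeeze_zero' ?_ ?_ hb
      · filter_upwards [self_mem_nhdsWithin] with x hx
        exact mul_nonneg (Real.rpow_nonneg hx.1 _) (by linarith [Real.cos_le_one x])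
      · filter_upwards [self_mem_nhdsWithin] with x hx
        rcases hx.1.eq_or_lt with h0 | h0
        · subst h0
          simp [Real.rpow_nonneg]
        · rw [sub_eq_neg_add 2 α, Real.rpow_add h0, Real.rpow_two]
          exact mul_le_mul_of_nonneg_left (one_sub_cos_le_sq x) (Real.rpow_nonneg h0.le _)
    · exact ((Real.continuousAt_rpow_const _ _ (Or.inl h0.ne')).mul
        (by fun_prop)).continuousWithinAt
  have h := intervalIntegral.integral_eq_sub_of_hasDerivAt_of_le hR.le hcont hderiv (hS.sub hK)
  rw [intervalIntegral.integral_sub hS hK] at h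
  simp only [Real.cos_zero, sub_self, mul_zero, sub_zero] at h
  rw [sineIntegral]
  linarith

theorem tendsto_sineIntegral {α : ℝ} (hα0 : 0 < α) (hα2 : α < 2) :
    Tendsto (sineIntegral α) atTop (𝓝 (stableIntegral α)) := by
  have h1 : Tendsto (fun R : ℝ => R ^ (-α) * (1 - Real.cos R)) atTop (𝓝 0) := by
    have hb : Tendsto (fun R : ℝ => R ^ (-α) * 2) atTop (𝓝 0) := by
      simpa using (tendsto_rpow_neg_atTop hα0).mul_const 2
    refine squeeze_zero' ?_ ?_ hb
    · filter_upwards [eventually_gt_atTop 0] with x hx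
      exact mul_nonneg (Real.rpow_nonneg hx.le _) (by linarith [Real.cos_le_one x])
    · filter_upwards [eventually_gt_atTop 0] with x hx
      exact mul_le_mul_of_nonneg_left (by linarith [Real.neg_one_le_cos x])
        (Real.rpow_nonneg hx.le _)
  have h2 := intervalIntegral_tendsto_integral_Ioi 0 (integrableOn_stableKernel hα0 hα2) tendsto_id
  have h3 := h1.add h2
  rw [zero_add] at h3
  refine h3.congr' ?_
  filter_upwards [eventually_gt_atTop 0] with R hR
  exact (sineIntegral_eq hα0 hα2 hR).symm

theorem stableConst_eq {α : ℝ} (hα0 : 0 < α) (hα2 : α < 2) :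
    stableConst α = (stableIntegral α)⁻¹ := by
  rw [stableConst, (tendsto_sineIntegral hα0 hα2).limUnder_eq]

/-- The integrand after the substitution `y = x^{-α}`, Jacobian included. It is already a dilate of
the kernel, so a second substitution by `|u|` removes one factor of `|u|^{α+1}`. -/
theorem stableKernel_scaled_eq {α u : ℝ} (hα0 : 0 < α) (hu : u ≠ 0) {x : ℝ} (hx : 0 < x) :
    (|-α| * x ^ (-α - 1)) • (1 - Real.cos (u * (x ^ (-α)) ^ (-(1 / α)))) =
      |u| ^ (α + 1) * stableKernel α (|u| * x) := by
  have hu' := abs_pos.2 hu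
  rw [← Real.rpow_mul hx.le, show -α * -(1 / α) = 1 by field_simp, Real.rpow_one, abs_neg,
    abs_of_pos hα0, smul_eq_mul, stableKernel, Real.mul_rpow hu'.le hx.le, sub_eq_add_neg (-α),
    ← neg_add, Real.rpow_neg hu'.le]
  have h : Real.cos (|u| * x) = Real.cos (u * x) := by
    rw [← Real.cos_abs (u * x), abs_mul, abs_of_pos hx]
  rw [h]
  have := (Real.rpow_pos_of_pos hu' (α + 1)).ne'
  field_simp

theorem integrableOn_one_sub_cos_rpow {α : ℝ} (hα0 : 0 < α) (hα2 : α < 2) (u : ℝ) :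
    IntegrableOn (fun y : ℝ => 1 - Real.cos (u * y ^ (-(1 / α)))) (Set.Ioi 0) := by
  rcases eq_or_ne u 0 with rfl | hu
  · simp
  rw [← integrableOn_Ioi_comp_rpow_iff _ (neg_ne_zero.2 hα0.ne'),
    integrableOn_congr_fun (fun x (hx : x ∈ Set.Ioi (0 : ℝ)) => stableKernel_scaled_eq hα0 hu hx) measurableSet_Ioi]
  refine Integrable.const_mul ?_ _
  have := (integrableOn_Ioi_comp_mul_left_iff (stableKernel α) 0 (abs_pos.2 hu)).2
    (by simpa using integrableOn_stableKernel hα0 hα2)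
  exact this

theorem integral_one_sub_cos_rpow {α : ℝ} (hα0 : 0 < α) (u : ℝ) :
    ∫ y in Set.Ioi (0 : ℝ), (1 - Real.cos (u * y ^ (-(1 / α)))) =
      |u| ^ α * stableIntegral α := by
  rcases eq_or_ne u 0 with rfl | hu
  · simp [Real.zero_rpow hα0.ne']
  have hu' := abs_pos.2 hu
  rw [← integral_comp_rpow_Ioi _ (neg_ne_zero.2 hα0.ne'),
    setIntegral_congr_fun measurableSet_Ioi (fun x (hx : x ∈ Set.Ioi (0 : ℝ)) => stableKernel_scaled_eq hα0 hu hx),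
    integral_const_mul, integral_comp_mul_left_Ioi _ _ hu', mul_zero, stableIntegral,
    smul_eq_mul, Real.rpow_add_one hu'.ne']
  field_simp

/-! ### Convergence of series of independent variables -/

section ThreeSeries

variable {Ω : Type*} [MeasurableSpace Ω] {P : Measure Ω} [IsProbabilityMeasure P]

/-- A series of independent centred random variables with summable variances converges almost
surely. -/
theorem ae_exists_tendsto_sum_of_summable_variance {Y : ℕ → Ω → ℝ}
    (hm : ∀ k, AEMeasurable (Y k) P) (hind : iIndepFun Y P) (hL2 : ∀ k, MemLp (Y k) 2 P)
    (h0 : ∀ k, ∫ ω, Y k ω ∂P = 0) (hsum : Summable fun k => ∫ ω, Y k ω ^ 2 ∂P) :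
    ∀ᵐ ω ∂P, ∃ l, Tendsto (fun n => ∑ k ∈ Finset.range n, Y k ω) atTop (𝓝 l) := by
  wlog hm' : ∀ k, Measurable (Y k) generalizing Y
  · have hae : ∀ k, Y k =ᵐ[P] (hm k).mk (Y k) := fun k => (hm k).ae_eq_mk
    have h := this (Y := fun k => (hm k).mk (Y k)) (fun k => (hm k).measurable_mk.aemeasurable)
      (hind.congr hae) (fun k => (memLp_congr_ae (hae k)).1 (hL2 k))
      (fun k => (integral_congr_ae (hae k)).symm.trans (h0 k))
      (hsum.congr fun k => integral_congr_ae ((hae k).mono fun ω h => by simp only [h]))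
      (fun k => (hm k).measurable_mk)
    filter_upwards [h, ae_all_iff.2 hae] with ω hω he
    simpa only [he] using hω
  have hint : ∀ k, Integrable (Y k) P := fun k => (hL2 k).integrable one_le_two
  have hsm : ∀ k, StronglyMeasurable (Y k) := fun k => (hm' k).stronglyMeasurable
  -- The sum runs through index `n`, so that it is adapted to the natural filtration at time `n`.
  have hmart : Martingale (fun n => ∑ k ∈ Finset.range (n + 1), Y k)
      (Filtration.natural Y hsm) P := by
    refine martingale_of_condExp_sub_eq_zero_nat (fun n => ?_)
      (fun n => integrable_finsetSum' _ fun k _ => hint k) fun n => ?_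
    · refine Finset.stronglyMeasurable_sum _ fun k hk => ?_
      exact ((Filtration.stronglyAdapted_natural hsm) k).mono
        ((Filtration.natural Y hsm).mono (by simpa [Nat.lt_succ_iff] using hk))
    · rw [Finset.sum_range_succ _ (n + 1), add_sub_cancel_left]
      filter_upwards [hind.condExp_natural_ae_eq_of_lt hsm (Nat.lt_succ_self n)] with ω h
      rw [h, h0, Pi.zero_apply]
  have hvar : ∀ n, ∫ ω, (∑ k ∈ Finset.range n, Y k ω) ^ 2 ∂P =
      ∑ k ∈ Finset.range n, ∫ ω, Y k ω ^ 2 ∂P := by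
    intro n
    have h := IndepFun.variance_sum (s := Finset.range n) (fun k _ => hL2 k)
      (fun i _ j _ hij => hind.indepFun hij)
    rw [variance_of_integral_eq_zero] at h
    · simp only [Finset.sum_apply] at h
      rw [h]
      exact Finset.sum_congr rfl fun k _ => variance_of_integral_eq_zero (hm k) (h0 k)
    · exact Finset.aemeasurable_sum _ fun k _ => hm k
    · simp only [Finset.sum_apply]
      rw [integral_finsetSum _ fun k _ => hint k]
      simp [h0]
  have hT : ∀ k, 0 ≤ ∫ ω, Y k ω ^ 2 ∂P := fun k => integral_nonneg fun ω => sq_nonneg _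
  have hbdd : ∀ n, eLpNorm (∑ k ∈ Finset.range (n + 1), Y k) 1 P ≤
      ((1 + ∑' k, ∫ ω, Y k ω ^ 2 ∂P).toNNReal : ℝ≥0∞) := by
    intro n
    have hi : Integrable (∑ k ∈ Finset.range (n + 1), Y k) P :=
      integrable_finsetSum' _ fun k _ => hint k
    have hsq : Integrable (fun ω => (∑ k ∈ Finset.range (n + 1), Y k ω) ^ 2) P := by
      have := (memLp_finsetSum' (Finset.range (n + 1)) fun k _ => hL2 k).integrable_sq
      simpa only [Finset.sum_apply] using this
    rw [eLpNorm_one_eq_lintegral_enorm, ← ofReal_integral_norm_eq_lintegral_enorm hi]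
    refine ENNReal.ofReal_le_ofReal ?_
    calc ∫ ω, ‖(∑ k ∈ Finset.range (n + 1), Y k) ω‖ ∂P
        ≤ ∫ ω, (1 + (∑ k ∈ Finset.range (n + 1), Y k ω) ^ 2) ∂P := by
          -- The inequality `|S| ≤ 1 + S²` turns the variance bound into the uniform `L¹` bound
          -- needed for martingale convergence.
          refine integral_mono hi.norm ((integrable_const 1).add hsq) fun ω => ?_
          simp only [Finset.sum_apply, Real.norm_eq_abs]
          rw [← sq_abs (∑ k ∈ Finset.range (n + 1), Y k ω)]
          nlinarith [sq_nonneg (|∑ k ∈ Finset.range (n + 1), Y k ω| - 1),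
            abs_nonneg (∑ k ∈ Finset.range (n + 1), Y k ω)]
      _ ≤ 1 + ∑' k, ∫ ω, Y k ω ^ 2 ∂P := by
          rw [integral_add (integrable_const 1) hsq, hvar]
          simpa using hsum.sum_le_tsum _ fun k _ => hT k
  filter_upwards [hmart.submartingale.ae_tendsto_limitProcess hbdd] with ω hω
  refine ⟨_, (tendsto_add_atTop_iff_nat 1).1 (hω.congr fun n => ?_)⟩
  rw [Finset.sum_apply]

/-- Truncation of a real number at level `1`. -/
def truncOne (x : ℝ) : ℝ := if |x| ≤ 1 then x else 0

theorem measurable_truncOne : Measurable truncOne :=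
  Measurable.ite (measurableSet_le measurable_norm measurable_const) measurable_id
    measurable_const

theorem truncOne_neg (x : ℝ) : truncOne (-x) = -truncOne x := by
  unfold truncOne
  rw [abs_neg]
  split_ifs <;> simp

theorem abs_truncOne_le_one (x : ℝ) : |truncOne x| ≤ 1 := by
  unfold truncOne
  split_ifs with h
  · exact h
  · simp

theorem integrable_truncOne_comp {X : Ω → ℝ} (hX : AEMeasurable X P) :
    Integrable (fun ω => truncOne (X ω)) P :=
  Integrable.of_bound (measurable_truncOne.comp_aemeasurable hX).aestronglyMeasurable 1
    (Eventually.of_forall fun _ => abs_truncOne_le_one _)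

theorem integrable_truncOne_comp_sq {X : Ω → ℝ} (hX : AEMeasurable X P) :
    Integrable (fun ω => truncOne (X ω) ^ 2) P :=
  Integrable.of_bound
    ((measurable_truncOne.comp_aemeasurable hX).pow_const 2).aestronglyMeasurable 1
    (Eventually.of_forall fun _ => by
      rw [norm_pow]
      exact pow_le_one₀ (norm_nonneg _) (abs_truncOne_le_one _))

/-- The sufficiency part of Kolmogorov's three-series theorem, for centred truncations. -/
theorem ae_exists_tendsto_sum_of_truncOne {X : ℕ → Ω → ℝ}
    (hm : ∀ k, AEMeasurable (X k) P) (hind : iIndepFun X P)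
    (hprob : Summable fun k => P.real {ω | 1 < |X k ω|})
    (h0 : ∀ k, ∫ ω, truncOne (X k ω) ∂P = 0)
    (hsum : Summable fun k => ∫ ω, truncOne (X k ω) ^ 2 ∂P) :
    ∀ᵐ ω ∂P, ∃ l, Tendsto (fun n => ∑ k ∈ Finset.range n, X k ω) atTop (𝓝 l) := by
  have hconv := ae_exists_tendsto_sum_of_summable_variance
    (Y := fun k ω => truncOne (X k ω)) (fun k => measurable_truncOne.comp_aemeasurable (hm k))
    (hind.comp (fun _ => truncOne) fun _ => measurable_truncOne)
    (fun k => MemLp.of_bound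
      (measurable_truncOne.comp_aemeasurable (hm k)).aestronglyMeasurable 1
      (Eventually.of_forall fun _ => abs_truncOne_le_one _)) h0 hsum
  -- By Borel–Cantelli, truncation changes only finitely many terms, so the two series differ by an
  -- eventually constant amount.
  have hBC : ∑' k, P {ω | 1 < |X k ω|} ≠ ∞ := by
    have := hprob.tsum_ofReal_ne_top
    simpa [ofReal_measureReal] using this
  filter_upwards [hconv, ae_eventually_notMem hBC] with ω ⟨l, hl⟩ hev
  obtain ⟨N, hN⟩ := eventually_atTop.1 hev
  refine ⟨l + ∑ k ∈ Finset.range N, (X k ω - truncOne (X k ω)),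
    (hl.add_const _).congr' ?_⟩
  filter_upwards [eventually_ge_atTop N] with n hn
  have h : ∑ k ∈ Finset.range N, (X k ω - truncOne (X k ω)) =
      ∑ k ∈ Finset.range n, (X k ω - truncOne (X k ω)) := by
    refine Finset.sum_subset (Finset.range_mono hn) fun k _ hk => ?_
    have hk' := hN k (by simpa using hk)
    simp only [not_lt] at hk'
    rw [truncOne, if_pos hk', sub_self]
  rw [h, Finset.sum_sub_distrib]
  ring

end ThreeSeries

/-! ### Freezing one of two independent variables; the exponential law -/

/-- Integrating a function of two independent random variables one variable at a time. -/
theorem IndepFun.integral_comp_prodMk {Ω S T : Type*} [MeasurableSpace Ω] [MeasurableSpace S]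
    [MeasurableSpace T] {P : Measure Ω} [IsProbabilityMeasure P] {X : Ω → S} {Y : Ω → T}
    {F : Type*} [NormedAddCommGroup F] [NormedSpace ℝ F]
    (hXY : IndepFun X Y P) (hX : AEMeasurable X P) (hY : AEMeasurable Y P)
    {Φ : S × T → F} (hΦ : StronglyMeasurable Φ)
    (hint : Integrable (fun ω => Φ (X ω, Y ω)) P) :
    ∫ ω, Φ (X ω, Y ω) ∂P = ∫ ω, ∫ y, Φ (X ω, y) ∂(P.map Y) ∂P := by
  have := Measure.isProbabilityMeasure_map hX
  have := Measure.isProbabilityMeasure_map hY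
  have hXY' := (indepFun_iff_map_prod_eq_prod_map_map hX hY).1 hXY
  have hint' : Integrable Φ ((P.map X).prod (P.map Y)) := by
    rw [← hXY']
    exact (integrable_map_measure hΦ.aestronglyMeasurable (hX.prodMk hY)).2 hint
  rw [← integral_map (φ := fun ω => (X ω, Y ω)) (hX.prodMk hY) hΦ.aestronglyMeasurable,
    hXY', integral_prod _ hint', integral_map hX]
  exact (StronglyMeasurable.integral_prod_right (f := fun x y => Φ (x, y))
    hΦ).aestronglyMeasurable

/-- An almost sure property of two independent random variables may be checked one variable at a
time. -/
theorem IndepFun.ae_prodMk_mem {Ω S T : Type*} [MeasurableSpace Ω] [MeasurableSpace S]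
    [MeasurableSpace T] {P : Measure Ω} [IsProbabilityMeasure P] {X : Ω → S} {Y : Ω → T}
    (hXY : IndepFun X Y P) (hX : AEMeasurable X P) (hY : AEMeasurable Y P)
    {C : Set (S × T)} (hC : MeasurableSet C) (h : ∀ᵐ ω ∂P, ∀ᵐ ω' ∂P, (X ω, Y ω') ∈ C) :
    ∀ᵐ ω ∂P, (X ω, Y ω) ∈ C := by
  have := Measure.isProbabilityMeasure_map hX
  have := Measure.isProbabilityMeasure_map hY
  refine ae_of_ae_map (hX.prodMk hY) (p := fun z => z ∈ C) ?_
  rw [(indepFun_iff_map_prod_eq_prod_map_map hX hY).1 hXY,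
    Measure.ae_prod_mem_iff_ae_ae_mem hC]
  have hm : MeasurableSet {x | ∀ᵐ y ∂(P.map Y), (x, y) ∈ C} :=
    measurable_measure_prodMk_left hC.compl (measurableSet_singleton 0)
  refine (ae_map_iff hX hm).2 (h.mono fun ω hω => ?_)
  exact (ae_map_iff hY (measurable_prodMk_left hC)).2 hω

theorem integral_expMeasure_one (g : ℝ → ℝ) :
    ∫ s, g s ∂(expMeasure 1) = ∫ s in Set.Ioi (0 : ℝ), Real.exp (-s) * g s := by
  rw [expMeasure, gammaMeasure, integral_withDensity_eq_integral_toReal_smul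
    (f := gammaPDF 1 1) (measurable_gammaPDFReal 1 1).ennreal_ofReal
    (Eventually.of_forall fun _ => ENNReal.ofReal_lt_top),
    ← integral_Ici_eq_integral_Ioi, ← integral_indicator measurableSet_Ici]
  congr 1 with s
  by_cases hs : 0 ≤ s
  · rw [Set.indicator_of_mem (by exact hs), gammaPDF_of_nonneg hs, ENNReal.toReal_ofReal]
    · simp
    · simpa using (Real.exp_pos _).le
  · rw [Set.indicator_of_notMem (by exact hs), gammaPDF_of_neg (not_le.1 hs)]
    simp

theorem ae_expMeasure_one_pos : ∀ᵐ s ∂(expMeasure 1), 0 < s := by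
  have h0 : expMeasure 1 {0} = 0 :=
    withDensity_absolutelyContinuous _ _ Real.volume_singleton
  have h1 : expMeasure 1 (Set.Iio 0) = 0 := by
    rw [expMeasure, gammaMeasure, withDensity_apply _ measurableSet_Iio]
    exact lintegral_exponentialPDF_of_nonpos le_rfl
  rw [ae_iff]
  refine measure_mono_null ?_ (measure_union_null h1 h0)
  intro s hs
  rcases (not_lt.1 hs).lt_or_eq with h | h
  · exact Or.inl h
  · exact Or.inr h

/-! ### The product functional of the Poisson process -/

section Poisson

/-- The exponential of minus the tail integral over `(x, ∞)` of `1 - G` restricted to `(0, ∞)`. -/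
def tailExp (G : ℝ → ℝ) (x : ℝ) : ℝ :=
  Real.exp ((∫ t in (0 : ℝ)..x, (Set.Ioi (0 : ℝ)).indicator (fun t => 1 - G t) t) -
    ∫ t, (Set.Ioi (0 : ℝ)).indicator (fun t => 1 - G t) t)

variable {G : ℝ → ℝ}

theorem tailExp_zero : tailExp G 0 = Real.exp (-∫ t in Set.Ioi (0 : ℝ), (1 - G t)) := by
  rw [tailExp, intervalIntegral.integral_same, zero_sub, integral_indicator measurableSet_Ioi]

theorem continuous_tailExp (hi : IntegrableOn (fun t => 1 - G t) (Set.Ioi 0)) :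
    Continuous (tailExp G) := by
  have hi' := hi.integrable_indicator measurableSet_Ioi
  exact Real.continuous_exp.comp ((intervalIntegral.continuous_primitive
    (fun a b => hi'.intervalIntegrable) 0).sub continuous_const)

theorem tailExp_le_one (hG : ∀ x, |G x| ≤ 1)
    (hi : IntegrableOn (fun t => 1 - G t) (Set.Ioi 0)) (x : ℝ) : tailExp G x ≤ 1 := by
  have hi' := hi.integrable_indicator measurableSet_Ioi
  have hnn : ∀ t, 0 ≤ (Set.Ioi (0 : ℝ)).indicator (fun t => 1 - G t) t :=
    fun t => Set.indicator_nonneg (fun t _ => by linarith [(abs_le.1 (hG t)).2]) t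
  refine Real.exp_le_one_iff.2 (sub_nonpos.2 ?_)
  -- Passing to absolute values treats `x < 0` together with `x ≥ 0`.
  refine (le_abs_self _).trans ?_
  rw [← Real.norm_eq_abs]
  refine intervalIntegral.norm_integral_le_integral_norm_uIoc.trans ?_
  simp only [Real.norm_of_nonneg (hnn _)]
  exact setIntegral_le_integral hi' (Eventually.of_forall hnn)

theorem abs_tailExp_le_one (hG : ∀ x, |G x| ≤ 1)
    (hi : IntegrableOn (fun t => 1 - G t) (Set.Ioi 0)) (x : ℝ) : |tailExp G x| ≤ 1 := by
  rw [tailExp, abs_of_pos (Real.exp_pos _)]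
  exact tailExp_le_one hG hi x

theorem tendsto_tailExp (hi : IntegrableOn (fun t => 1 - G t) (Set.Ioi 0)) :
    Tendsto (tailExp G) atTop (𝓝 1) := by
  have hi' := hi.integrable_indicator measurableSet_Ioi
  have h := intervalIntegral_tendsto_integral_Ioi 0 hi'.integrableOn tendsto_id
  have he : ∫ t in Set.Ioi (0 : ℝ), (Set.Ioi (0 : ℝ)).indicator (fun t => 1 - G t) t =
      ∫ t, (Set.Ioi (0 : ℝ)).indicator (fun t => 1 - G t) t := by
    rw [setIntegral_indicator measurableSet_Ioi, Set.inter_self,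
      integral_indicator measurableSet_Ioi]
  rw [he] at h
  have := (h.sub_const (∫ t, (Set.Ioi (0 : ℝ)).indicator (fun t => 1 - G t) t)).rexp
  rw [sub_self, Real.exp_zero] at this
  exact this

/-- The differential equation `F' = (1 - G) F` is what makes `F` compensate the factors `G`: it
gives `(e^{-s} F)' = -e^{-s} G F`. -/
theorem hasDerivAt_tailExp (hm : Measurable G) (hc : ContinuousOn G (Set.Ioi 0))
    (hi : IntegrableOn (fun t => 1 - G t) (Set.Ioi 0)) {x : ℝ} (hx : 0 < x) :
    HasDerivAt (tailExp G) (tailExp G x * (1 - G x)) x := by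
  have hi' := hi.integrable_indicator measurableSet_Ioi
  have hG : ContinuousAt G x := hc.continuousAt (Ioi_mem_nhds hx)
  have hc' : ContinuousAt ((Set.Ioi (0 : ℝ)).indicator fun t => 1 - G t) x := by
    refine ((continuousAt_const (y := (1 : ℝ))).sub hG).congr ?_
    filter_upwards [Ioi_mem_nhds hx] with t ht
    rw [Set.indicator_of_mem ht]
    rfl
  have h := intervalIntegral.integral_hasDerivAt_right (a := 0) (b := x)
    hi'.intervalIntegrable
    (((measurable_const.sub hm).indicator
      measurableSet_Ioi).stronglyMeasurable.stronglyMeasurableAtFilter) hc'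
  rw [Set.indicator_of_mem (by exact hx)] at h
  exact (h.sub_const _).exp

/-- The martingale identity for one exponential waiting time. -/
theorem integral_mul_tailExp (hm : Measurable G) (hG : ∀ x, |G x| ≤ 1)
    (hc : ContinuousOn G (Set.Ioi 0))
    (hi : IntegrableOn (fun t => 1 - G t) (Set.Ioi 0)) {x : ℝ} (hx : 0 ≤ x) :
    ∫ s, G (x + s) * tailExp G (x + s) ∂(expMeasure 1) = tailExp G x := by
  rw [integral_expMeasure_one]
  have hF := continuous_tailExp hi
  have hexp : IntegrableOn (fun s : ℝ => Real.exp (-s)) (Set.Ioi 0) := by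
    simpa using integrableOn_exp_neg_Ioi 0
  have hb : ∀ y, ‖tailExp G y‖ ≤ 1 := abs_tailExp_le_one hG hi
  -- By the differential equation, the exponential density times `G F` has the primitive `-e^{-s}
  -- F(x + s)`, equal to `-F(x)` at `0` and vanishing at infinity.
  have h := integral_Ioi_of_hasDerivAt_of_tendsto (a := 0) (m := 0)
    (f := fun s => -(Real.exp (-s) * tailExp G (x + s)))
    (f' := fun s => Real.exp (-s) * (G (x + s) * tailExp G (x + s))) ?_ ?_ ?_ ?_
  · rw [h]
    simp
  · exact Continuous.continuousWithinAt (by fun_prop)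
  · intro s hs
    have h1 : HasDerivAt (fun s : ℝ => Real.exp (-s)) (-Real.exp (-s)) s := by
      simpa using (hasDerivAt_neg s).exp
    have h2 : HasDerivAt (fun s => tailExp G (x + s))
        (tailExp G (x + s) * (1 - G (x + s))) s :=
      (hasDerivAt_tailExp hm hc hi (add_pos_of_nonneg_of_pos hx hs)).comp_const_add x s
    convert! (h1.mul h2).neg using 1
    ring
  · refine hexp.mono' (by fun_prop : Measurable _).aestronglyMeasurable
      (Eventually.of_forall fun s => ?_)
    rw [norm_mul, Real.norm_of_nonneg (Real.exp_pos _).le, norm_mul]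
    exact mul_le_of_le_one_right (Real.exp_pos _).le
      (mul_le_one₀ (hG _) (norm_nonneg _) (hb _))
  · have h0 : Tendsto (fun s : ℝ => Real.exp (-s)) atTop (𝓝 0) :=
      Real.tendsto_exp_neg_atTop_nhds_zero
    rw [← neg_zero]
    refine (squeeze_zero_norm (fun s => ?_) h0).neg
    rw [norm_mul, Real.norm_of_nonneg (Real.exp_pos _).le]
    exact mul_le_of_le_one_right (Real.exp_pos _).le (hb _)

variable {Ω : Type*} [MeasurableSpace Ω] {P : Measure Ω} {τ : ℕ → Ω → ℝ}

theorem ae_waitingTime_pos (hlaw : ∀ j, HasLaw (τ j) (expMeasure 1) P) :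
    ∀ᵐ ω ∂P, ∀ j, 0 < τ j ω := by
  refine ae_all_iff.2 fun j => ?_
  have h := ae_expMeasure_one_pos
  rw [← (hlaw j).map_eq] at h
  exact ae_of_ae_map (hlaw j).aemeasurable h

variable [IsProbabilityMeasure P]

/-- The arrival times of a Poisson process grow at least linearly. -/
theorem exists_linear_le_arrivalTime (hind : iIndepFun τ P)
    (hlaw : ∀ j, HasLaw (τ j) (expMeasure 1) P) :
    ∃ c > 0, ∀ᵐ ω ∂P, ∀ᶠ n : ℕ in atTop, c * n ≤ ∑ j ∈ Finset.range n, τ j ω := by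
  -- Capping the waiting times at `1` makes integrability immediate; the strong law then gives any
  -- slope below the positive capped mean, and half of it is taken.
  have hmin : Measurable fun x : ℝ => min x 1 := measurable_id.min measurable_const
  have hpos := ae_waitingTime_pos hlaw
  have hI : Integrable (fun ω => min (τ 0 ω) 1) P := by
    refine Integrable.of_bound (hmin.comp_aemeasurable (hlaw 0).aemeasurable).aestronglyMeasurable
      1 ?_
    filter_upwards [hpos] with ω h
    rw [Real.norm_of_nonneg (le_min (h 0).le zero_le_one)]
    exact min_le_right _ _
  have hmean : 0 < ∫ ω, min (τ 0 ω) 1 ∂P := by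
    refine (integral_pos_iff_support_of_nonneg_ae (hpos.mono fun ω h =>
      le_min (h 0).le zero_le_one) hI).2 ?_
    have h1 : ∀ᵐ ω ∂P, ω ∈ Function.support fun ω => min (τ 0 ω) 1 :=
      hpos.mono fun ω h => (lt_min (h 0) one_pos).ne'
    refine pos_iff_ne_zero.2 fun h0 => ?_
    obtain ⟨ω, hω, hω'⟩ := (h1.and (measure_eq_zero_iff_ae_notMem.1 h0)).exists
    exact hω' hω
  refine ⟨(∫ ω, min (τ 0 ω) 1 ∂P) / 2, half_pos hmean, ?_⟩
  have hslln := strong_law_ae_real (fun j ω => min (τ j ω) 1) hI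
    (fun i j hij => (hind.indepFun hij).comp hmin hmin) (fun i =>
      (IdentDistrib.comp ⟨(hlaw i).aemeasurable, (hlaw 0).aemeasurable,
        (hlaw i).map_eq.trans (hlaw 0).map_eq.symm⟩ hmin))
  filter_upwards [hslln] with ω hω
  filter_upwards [hω.eventually (lt_mem_nhds (half_lt_self hmean)), eventually_gt_atTop 0]
    with n hn hn0
  rw [lt_div_iff₀ (by exact_mod_cast hn0)] at hn
  exact hn.le.trans (Finset.sum_le_sum fun j _ => min_le_left _ _)

/-- With `T_n` the `n`-th arrival time, `∏_{k ≤ n} G(T_k) · F(T_n)` is a martingale: integrating out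
the next waiting time, independent of the past, is `integral_mul_tailExp`. -/
theorem integral_prod_arrivalTime_mul_tailExp (hind : iIndepFun τ P)
    (hlaw : ∀ j, HasLaw (τ j) (expMeasure 1) P) (hτ : ∀ j, Measurable (τ j))
    (hm : Measurable G) (hG : ∀ x, |G x| ≤ 1)
    (hc : ContinuousOn G (Set.Ioi 0)) (hi : IntegrableOn (fun t => 1 - G t) (Set.Ioi 0)) (n : ℕ) :
    ∫ ω, (∏ k ∈ Finset.range n, G (∑ j ∈ Finset.range (k + 1), τ j ω)) *
      tailExp G (∑ j ∈ Finset.range n, τ j ω) ∂P = tailExp G 0 := by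
  induction n with
  | zero => simp
  | succ n ih =>
    rw [← ih]
    have hF := (continuous_tailExp hi).measurable
    -- Extension by zero of the first `n` waiting times. It exhibits the past as a measurable
    -- function of a finite tuple, the form in which independence from `τ n` is available.
    let e : ((Finset.range n) → ℝ) → ℕ → ℝ :=
      fun y j => if h : j ∈ Finset.range n then y ⟨j, h⟩ else 0
    have he : ∀ j, Measurable fun y => e y j := by
      intro j
      by_cases h : j ∈ Finset.range n
      · simp only [e, dif_pos h]
        exact measurable_pi_apply _
      · simp only [e, dif_neg h]
        exact measurable_const
    let φ : ((Finset.range n) → ℝ) → ℝ × ℝ := fun y =>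
      (∏ k ∈ Finset.range n, G (∑ j ∈ Finset.range (k + 1), e y j), ∑ j ∈ Finset.range n, e y j)
    have hφ : Measurable φ :=
      (Finset.measurable_prod _ fun k _ => hm.comp
        (Finset.measurable_sum _ fun j _ => he j)).prodMk
        (Finset.measurable_sum _ fun j _ => he j)
    have hφe : ∀ ω, φ (fun i => τ i ω) =
        (∏ k ∈ Finset.range n, G (∑ j ∈ Finset.range (k + 1), τ j ω),
          ∑ j ∈ Finset.range n, τ j ω) := by
      intro ω
      have h : ∀ j ∈ Finset.range n, e (fun i => τ i ω) j = τ j ω := fun j hj => dif_pos hj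
      refine Prod.ext ?_ (Finset.sum_congr rfl h)
      show ∏ k ∈ Finset.range n, G (∑ j ∈ Finset.range (k + 1), e (fun i => τ i ω) j) =
        ∏ k ∈ Finset.range n, G (∑ j ∈ Finset.range (k + 1), τ j ω)
      refine Finset.prod_congr rfl fun k hk => ?_
      refine congrArg G (Finset.sum_congr rfl fun j hj => h j ?_)
      simp only [Finset.mem_range] at hk hj ⊢
      omega
    have hI : IndepFun
        (fun ω => (∏ k ∈ Finset.range n, G (∑ j ∈ Finset.range (k + 1), τ j ω),
          ∑ j ∈ Finset.range n, τ j ω)) (τ n) P := by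
      have hψ : Measurable fun y : ({n} : Finset ℕ) → ℝ => y ⟨n, Finset.mem_singleton_self n⟩ :=
        measurable_pi_apply _
      have h := (hind.indepFun_finset (Finset.range n) {n} (by simp) hτ).comp hφ hψ
      have h' : (φ ∘ fun ω (i : Finset.range n) => τ i ω) = fun ω =>
          (∏ k ∈ Finset.range n, G (∑ j ∈ Finset.range (k + 1), τ j ω),
            ∑ j ∈ Finset.range n, τ j ω) := funext hφe
      rwa [h'] at h
    have hT : ∀ n, Measurable fun ω => ∑ j ∈ Finset.range n, τ j ω :=
      fun n => Finset.measurable_sum _ fun j _ => hτ j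
    have hA : ∀ n, Measurable fun ω =>
        ∏ k ∈ Finset.range n, G (∑ j ∈ Finset.range (k + 1), τ j ω) :=
      fun n => Finset.measurable_prod _ fun k _ => hm.comp (hT (k + 1))
    have hprod : ∀ n ω, |∏ k ∈ Finset.range n, G (∑ j ∈ Finset.range (k + 1), τ j ω)| ≤ 1 := by
      intro n ω
      rw [Finset.abs_prod]
      exact Finset.prod_le_one (fun _ _ => abs_nonneg _) fun _ _ => hG _
    have hint : Integrable (fun ω =>
        (∏ k ∈ Finset.range (n + 1), G (∑ j ∈ Finset.range (k + 1), τ j ω)) *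
          tailExp G (∑ j ∈ Finset.range (n + 1), τ j ω)) P := by
      refine Integrable.of_bound ((hA (n + 1)).mul
        (hF.comp (hT (n + 1)))).aestronglyMeasurable 1 (Eventually.of_forall fun ω => ?_)
      rw [norm_mul]
      exact mul_le_one₀ (hprod _ _) (norm_nonneg _) (abs_tailExp_le_one hG hi _)
    simp only [Finset.prod_range_succ, Finset.sum_range_succ _ n, mul_assoc] at hint ⊢
    have h := IndepFun.integral_comp_prodMk hI ((hA n).prodMk (hT n)).aemeasurable
      (hτ n).aemeasurable
      (Φ := fun z => z.1.1 * (G (z.1.2 + z.2) * tailExp G (z.1.2 + z.2)))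
      (by fun_prop : Measurable _).stronglyMeasurable hint
    refine h.trans (integral_congr_ae ?_)
    filter_upwards [ae_waitingTime_pos hlaw] with ω hω
    rw [integral_const_mul, (hlaw n).map_eq, integral_mul_tailExp hm hG hc hi
      (Finset.sum_nonneg fun j _ => (hω j).le)]

/-- The product functional of a Poisson process. -/
theorem tendsto_integral_prod_arrivalTime (hind : iIndepFun τ P)
    (hlaw : ∀ j, HasLaw (τ j) (expMeasure 1) P)
    (hm : Measurable G) (hG : ∀ x, |G x| ≤ 1)
    (hc : ContinuousOn G (Set.Ioi 0)) (hi : IntegrableOn (fun t => 1 - G t) (Set.Ioi 0)) :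
    Tendsto (fun n => ∫ ω, ∏ k ∈ Finset.range n, G (∑ j ∈ Finset.range (k + 1), τ j ω) ∂P)
      atTop (𝓝 (Real.exp (-∫ t in Set.Ioi (0 : ℝ), (1 - G t)))) := by
  wlog hτ : ∀ j, Measurable (τ j) generalizing τ
  · have hae := fun j => (hlaw j).aemeasurable.ae_eq_mk
    have h := this (τ := fun j => (hlaw j).aemeasurable.mk (τ j)) (hind.congr hae)
      (fun j => (hlaw j).congr (hae j).symm) (fun j => (hlaw j).aemeasurable.measurable_mk)
    refine h.congr fun n => integral_congr_ae ?_
    filter_upwards [ae_all_iff.2 hae] with ω hω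
    simp only [hω]
  have hF := continuous_tailExp hi
  have hT : ∀ n, Measurable fun ω => ∑ j ∈ Finset.range n, τ j ω :=
    fun n => Finset.measurable_sum _ fun j _ => hτ j
  have hA : ∀ n, Measurable fun ω =>
      ∏ k ∈ Finset.range n, G (∑ j ∈ Finset.range (k + 1), τ j ω) :=
    fun n => Finset.measurable_prod _ fun k _ => hm.comp (hT (k + 1))
  have hprod : ∀ n ω, |∏ k ∈ Finset.range n, G (∑ j ∈ Finset.range (k + 1), τ j ω)| ≤ 1 := by
    intro n ω
    rw [Finset.abs_prod]
    exact Finset.prod_le_one (fun _ _ => abs_nonneg _) fun _ _ => hG _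
  have hA' : ∀ n, Integrable (fun ω =>
      ∏ k ∈ Finset.range n, G (∑ j ∈ Finset.range (k + 1), τ j ω)) P := fun n =>
    Integrable.of_bound (hA n).aestronglyMeasurable 1 (Eventually.of_forall (hprod n))
  have hFm : ∀ n, Measurable fun ω => tailExp G (∑ j ∈ Finset.range n, τ j ω) :=
    fun n => hF.measurable.comp (hT n)
  have hB : ∀ n, Integrable (fun ω =>
      (∏ k ∈ Finset.range n, G (∑ j ∈ Finset.range (k + 1), τ j ω)) *
        tailExp G (∑ j ∈ Finset.range n, τ j ω)) P := fun n =>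
    (hA' n).mul_bdd (c := 1) (hFm n).aestronglyMeasurable
      (Eventually.of_forall fun ω => abs_tailExp_le_one hG hi _)
  -- Since `T_n → ∞` and `F → 1` at infinity, the compensating factor disappears in the limit of the
  -- martingale identity.
  have hdiff : Tendsto (fun n => ∫ ω,
      (∏ k ∈ Finset.range n, G (∑ j ∈ Finset.range (k + 1), τ j ω)) *
        (1 - tailExp G (∑ j ∈ Finset.range n, τ j ω)) ∂P) atTop (𝓝 0) := by
    rw [← integral_zero Ω ℝ (μ := P)]
    refine tendsto_integral_of_dominated_convergence (fun _ => 2)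
      (fun n => ((hA n).mul (measurable_const.sub (hFm n))).aestronglyMeasurable)
      (integrable_const _) (fun n => Eventually.of_forall fun ω => ?_) ?_
    · rw [norm_mul]
      have h1 := abs_le.1 (abs_tailExp_le_one hG hi (∑ j ∈ Finset.range n, τ j ω))
      have h2 : ‖1 - tailExp G (∑ j ∈ Finset.range n, τ j ω)‖ ≤ 2 :=
        abs_le.2 ⟨by linarith, by linarith⟩
      nlinarith [hprod n ω, norm_nonneg (1 - tailExp G (∑ j ∈ Finset.range n, τ j ω)),
        Real.norm_eq_abs (∏ k ∈ Finset.range n, G (∑ j ∈ Finset.range (k + 1), τ j ω))]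
    · obtain ⟨c, hc0, hlin⟩ := exists_linear_le_arrivalTime hind hlaw
      filter_upwards [hlin] with ω hω
      have hinf : Tendsto (fun n => ∑ j ∈ Finset.range n, τ j ω) atTop atTop :=
        tendsto_atTop_mono' _ hω (tendsto_natCast_atTop_atTop.const_mul_atTop hc0)
      have h1 := (((tendsto_tailExp hi).comp hinf).const_sub 1)
      rw [sub_self] at h1
      refine squeeze_zero_norm (fun n => ?_) (h1.norm.trans (by simp))
      rw [norm_mul]
      exact mul_le_of_le_one_left (norm_nonneg _) (hprod n ω)
  rw [← tailExp_zero, ← zero_add (tailExp G 0)]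
  refine (hdiff.add_const (tailExp G 0)).congr fun n => ?_
  have h := integral_prod_arrivalTime_mul_tailExp hind hlaw hτ hm hG hc hi n
  rw [← h, ← integral_add _ (hB n)]
  · congr 1 with ω
    ring
  · have := (hA' n).sub (hB n)
    refine this.congr (Eventually.of_forall fun ω => ?_)
    simp only [Pi.sub_apply]
    ring

end Poisson

/-! ### Averaging over a fair sign -/

section FairSign

theorem prod_fairSign {X : Type*} [MeasurableSpace X] (ν : Measure X) [SFinite ν] :
    ν.prod fairSign = (2⁻¹ : ℝ≥0∞) • ν.map (fun x => (x, (1 : ℝ))) +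
      (2⁻¹ : ℝ≥0∞) • ν.map (fun x => (x, (-1 : ℝ))) := by
  rw [fairSign, Measure.prod_add, Measure.prod_smul_right, Measure.prod_smul_right,
    Measure.prod_dirac, Measure.prod_dirac]

theorem integral_prod_fairSign {X F : Type*} [MeasurableSpace X] {ν : Measure X} [SFinite ν]
    [NormedAddCommGroup F] [NormedSpace ℝ F] {h : X × ℝ → F} (hh : StronglyMeasurable h)
    (h1 : Integrable (fun x => h (x, 1)) ν) (h2 : Integrable (fun x => h (x, -1)) ν) :
    ∫ z, h z ∂(ν.prod fairSign) =
      (2⁻¹ : ℝ) • (∫ x, h (x, 1) ∂ν + ∫ x, h (x, -1) ∂ν) := by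
  have m1 : Measurable fun x : X => (x, (1 : ℝ)) := by fun_prop
  have m2 : Measurable fun x : X => (x, (-1 : ℝ)) := by fun_prop
  rw [prod_fairSign, integral_add_measure, integral_smul_measure, integral_smul_measure,
    integral_map m1.aemeasurable hh.aestronglyMeasurable,
    integral_map m2.aemeasurable hh.aestronglyMeasurable, smul_add]
  · simp
  · exact ((integrable_map_measure hh.aestronglyMeasurable m1.aemeasurable).2 h1).smul_measure
      (by simp)
  · exact ((integrable_map_measure hh.aestronglyMeasurable m2.aemeasurable).2 h2).smul_measure
      (by simp)

/-- Truncation is odd, so the two signs cancel; the centring condition of the three-series criterion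
is therefore automatic. -/
theorem integral_truncOne_prod_fairSign {X : Type*} [MeasurableSpace X] {ν : Measure X}
    [IsProbabilityMeasure ν] {f : X → ℝ} (hf : Measurable f) (a : ℝ) :
    ∫ z, truncOne (z.2 * a * f z.1) ∂(ν.prod fairSign) = 0 := by
  have hm := measurable_truncOne
  rw [integral_prod_fairSign (h := fun z => truncOne (z.2 * a * f z.1))
    (by fun_prop : Measurable _).stronglyMeasurable
    (integrable_truncOne_comp (by fun_prop)) (integrable_truncOne_comp (by fun_prop))]
  have h : ∀ x, truncOne (-1 * a * f x) = -truncOne (1 * a * f x) := fun x => by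
    rw [← truncOne_neg]
    ring_nf
  simp only [h, integral_neg, add_neg_cancel, smul_zero]

theorem integral_rpow_prod_fairSign {X : Type*} [MeasurableSpace X] {ν : Measure X}
    [IsProbabilityMeasure ν] {f : X → ℝ} (hf : Measurable f) (a : ℝ) {p : ℝ}
    (hfp : Integrable (fun x => |f x| ^ p) ν) :
    ∫ z, |z.2 * a * f z.1| ^ p ∂(ν.prod fairSign) = |a| ^ p * ∫ x, |f x| ^ p ∂ν := by
  have e1 : ∀ x, |1 * a * f x| ^ p = |a| ^ p * |f x| ^ p := fun x => by
    rw [one_mul, abs_mul, Real.mul_rpow (abs_nonneg _) (abs_nonneg _)]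
  have e2 : ∀ x, |-1 * a * f x| ^ p = |a| ^ p * |f x| ^ p := fun x => by
    rw [← e1, ← abs_neg]
    ring_nf
  rw [integral_prod_fairSign (h := fun z => |z.2 * a * f z.1| ^ p)
    (by fun_prop : Measurable _).stronglyMeasurable
    (by simpa only [e1] using hfp.const_mul _) (by simpa only [e2] using hfp.const_mul _)]
  simp only [e1, e2, integral_const_mul, smul_eq_mul]
  ring

theorem integrable_rpow_prod_fairSign {X : Type*} [MeasurableSpace X] {ν : Measure X}
    [IsProbabilityMeasure ν] {f : X → ℝ} (hf : Measurable f) (a : ℝ) {p : ℝ}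
    (hfp : Integrable (fun x => |f x| ^ p) ν) :
    Integrable (fun z : X × ℝ => |z.2 * a * f z.1| ^ p) (ν.prod fairSign) := by
  have e1 : ∀ x, |1 * a * f x| ^ p = |a| ^ p * |f x| ^ p := fun x => by
    rw [one_mul, abs_mul, Real.mul_rpow (abs_nonneg _) (abs_nonneg _)]
  have e2 : ∀ x, |-1 * a * f x| ^ p = |a| ^ p * |f x| ^ p := fun x => by
    rw [← e1, ← abs_neg]
    ring_nf
  have hm : Measurable fun z : X × ℝ => |z.2 * a * f z.1| ^ p := by fun_prop
  rw [prod_fairSign]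
  refine Integrable.add_measure ?_ ?_
  · refine Integrable.smul_measure ?_ (by simp)
    rw [integrable_map_measure hm.aestronglyMeasurable (by fun_prop)]
    simpa only [Function.comp_def, e1] using hfp.const_mul _
  · refine Integrable.smul_measure ?_ (by simp)
    rw [integrable_map_measure hm.aestronglyMeasurable (by fun_prop)]
    simpa only [Function.comp_def, e2] using hfp.const_mul _

end FairSign

/-! ### Randomly signed series with fixed coefficients -/

section SignedSeries

variable {Ω : Type*} [MeasurableSpace Ω] {P : Measure Ω} [IsProbabilityMeasure P]
  {X : Type*} [MeasurableSpace X] {ν : Measure X} [IsProbabilityMeasure ν]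
  {V : ℕ → Ω → X} {ρ : ℕ → Ω → ℝ} {f : X → ℝ} {p : ℝ}

theorem truncOne_sq_le {x : ℝ} (hp0 : 0 < p) (hp2 : p ≤ 2) : truncOne x ^ 2 ≤ |x| ^ p := by
  unfold truncOne
  split_ifs with h
  · rw [← sq_abs, ← Real.rpow_two]
    rcases (abs_nonneg x).eq_or_lt with h0 | h0
    · rw [← h0, Real.zero_rpow two_ne_zero, Real.zero_rpow hp0.ne']
    · exact Real.rpow_le_rpow_of_exponent_ge h0 h hp2
  · simpa using Real.rpow_nonneg (abs_nonneg x) p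

/-- A randomly signed series with deterministic `p`-summable coefficients converges. -/
theorem ae_exists_tendsto_signedSum (hW : iIndepFun (fun k ω => (V k ω, ρ k ω)) P)
    (hlaw : ∀ k, HasLaw (fun ω => (V k ω, ρ k ω)) (ν.prod fairSign) P)
    (hf : Measurable f) (hp0 : 0 < p) (hp2 : p ≤ 2)
    (hfp : Integrable (fun x => |f x| ^ p) ν) {a : ℕ → ℝ} (ha : Summable fun k => |a k| ^ p) :
    ∀ᵐ ω ∂P, ∃ l, Tendsto (fun n => ∑ k ∈ Finset.range n, ρ k ω * a k * f (V k ω)) atTop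
      (𝓝 l) := by
  let g : ℕ → X × ℝ → ℝ := fun k z => z.2 * a k * f z.1
  have hg : ∀ k, Measurable (g k) := fun k => by fun_prop
  have hgm : ∀ k, AEMeasurable (fun ω => g k (V k ω, ρ k ω)) P :=
    fun k => (hg k).comp_aemeasurable (hlaw k).aemeasurable
  have hint : ∀ k, Integrable (fun ω => |g k (V k ω, ρ k ω)| ^ p) P := fun k => by
    have h := integrable_rpow_prod_fairSign hf (a k) hfp
    rw [← (hlaw k).map_eq] at h
    exact h.comp_aemeasurable (hlaw k).aemeasurable
  have hval : ∀ k, ∫ ω, |g k (V k ω, ρ k ω)| ^ p ∂P = |a k| ^ p * ∫ x, |f x| ^ p ∂ν :=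
    fun k => ((hlaw k).integral_comp (f := fun z => |g k z| ^ p)
      ((hg k).norm.pow_const p).aestronglyMeasurable).trans
      (integral_rpow_prod_fairSign hf (a k) hfp)
  have hsum : Summable fun k => ∫ ω, |g k (V k ω, ρ k ω)| ^ p ∂P := by
    simpa only [hval] using ha.mul_right _
  refine ae_exists_tendsto_sum_of_truncOne (X := fun k ω => g k (V k ω, ρ k ω)) hgm
    (hW.comp g hg) ?_ ?_ ?_
  -- Markov's inequality for the `p`-th moment at level `1`; the same moments dominate the truncated
  -- variances because `p ≤ 2`.
  · refine hsum.of_nonneg_of_le (fun k => measureReal_nonneg) fun k => ?_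
    have h := mul_meas_ge_le_integral_of_nonneg (μ := P)
      (Eventually.of_forall fun ω => Real.rpow_nonneg (abs_nonneg (g k (V k ω, ρ k ω))) p)
      (hint k) 1
    rw [one_mul] at h
    refine LE.le.trans (measureReal_mono fun ω hω => ?_) h
    rw [Set.mem_ofPred_eq] at hω ⊢
    exact Real.one_le_rpow hω.le hp0.le
  · intro k
    exact ((hlaw k).integral_comp (f := fun z => truncOne (g k z))
      (measurable_truncOne.comp (hg k)).aestronglyMeasurable).trans
      (integral_truncOne_prod_fairSign hf (a k))
  · refine hsum.of_nonneg_of_le (fun k => integral_nonneg fun ω => sq_nonneg _) fun k => ?_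
    exact integral_mono (integrable_truncOne_comp_sq (hgm k)) (hint k)
      fun ω => truncOne_sq_le hp0 hp2

end SignedSeries

/-! ### Convergence of the marked Poisson series -/

/-- Arrival times of a Poisson process with rate `1`, marked by independent points with law `ν`
and independent fair signs. -/
structure IsSignedMarkedPoisson {Ω X : Type*} [MeasurableSpace Ω] [MeasurableSpace X]
    (Γ : ℕ → Ω → ℝ) (V : ℕ → Ω → X) (ρ : ℕ → Ω → ℝ) (ν : Measure X) (P : Measure Ω) : Prop where
  arrival : IsPoissonArrivalTimes Γ P
  iIndep : iIndepFun (fun k ω => (V k ω, ρ k ω)) P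
  hasLaw : ∀ k, HasLaw (fun ω => (V k ω, ρ k ω)) (ν.prod fairSign) P
  indep : IndepFun (fun ω k => Γ k ω) (fun ω k => (V k ω, ρ k ω)) P

namespace IsSignedMarkedPoisson

variable {Ω : Type*} [MeasurableSpace Ω] {P : Measure Ω}
  {X : Type*} [MeasurableSpace X] {ν : Measure X}
  {Γ : ℕ → Ω → ℝ} {V : ℕ → Ω → X} {ρ : ℕ → Ω → ℝ} {f : X → ℝ} {α p : ℝ}

theorem aemeasurable_arrival (h : IsSignedMarkedPoisson Γ V ρ ν P) (k : ℕ) :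
    AEMeasurable (Γ k) P := by
  obtain ⟨τ, -, hlaw, hΓ⟩ := h.arrival
  exact (Finset.aemeasurable_fun_sum _ fun j _ => (hlaw j).aemeasurable).congr
    (EventuallyEq.symm (hΓ k))

variable [IsProbabilityMeasure P]

theorem ae_arrival (h : IsSignedMarkedPoisson Γ V ρ ν P) :
    ∃ c > 0, ∀ᵐ ω ∂P, (∀ k, 0 < Γ k ω) ∧ ∀ᶠ k : ℕ in atTop, c * (k + 1 : ℕ) ≤ Γ k ω := by
  obtain ⟨τ, hind, hlaw, hΓ⟩ := h.arrival
  obtain ⟨c, hc0, hc⟩ := exists_linear_le_arrivalTime hind hlaw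
  refine ⟨c, hc0, ?_⟩
  filter_upwards [hc, ae_all_iff.2 hΓ, ae_waitingTime_pos hlaw] with ω h1 h2 h3
  refine ⟨fun k => ?_, ?_⟩
  · rw [h2]
    exact Finset.sum_pos (fun j _ => h3 j) ⟨0, by simp⟩
  · simp only [h2]
    exact (tendsto_add_atTop_nat 1).eventually h1

/-- Linear growth of `Γ` reduces the claim to `∑ (k + 1)^{-p/α}`, which converges because `p > α`.
-/
theorem ae_summable_arrival_rpow (h : IsSignedMarkedPoisson Γ V ρ ν P) (hα0 : 0 < α)
    (hp : α < p) : ∀ᵐ ω ∂P, Summable fun k => |Γ k ω ^ (-(1 / α))| ^ p := by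
  obtain ⟨c, hc0, hc⟩ := h.ae_arrival
  filter_upwards [hc] with ω ⟨hpos, hlin⟩
  have hq : 1 < p / α := (one_lt_div hα0).2 hp
  have hs : Summable fun k : ℕ => c ^ (-(p / α)) * ((k + 1 : ℕ) : ℝ) ^ (-(p / α)) :=
    ((summable_nat_add_iff 1).2 (Real.summable_nat_rpow.2 (by linarith))).mul_left _
  refine Summable.of_norm_bounded_eventually_nat hs ?_
  filter_upwards [hlin] with k hk
  have hk0 : (0 : ℝ) < (k + 1 : ℕ) := by positivity
  rw [abs_of_pos (Real.rpow_pos_of_pos (hpos k) _), ← Real.rpow_mul (hpos k).le,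
    Real.norm_of_nonneg (Real.rpow_nonneg (hpos k).le _), ← Real.mul_rpow hc0.le hk0.le,
    show -(1 / α) * p = -(p / α) by ring]
  exact Real.rpow_le_rpow_of_nonpos (mul_pos hc0 hk0) hk (by linarith)

/-- Fubini on the measurable set of convergence: for almost every frozen sequence of arrival times
the coefficients are `p`-summable. -/
theorem ae_exists_tendsto [IsProbabilityMeasure ν] (h : IsSignedMarkedPoisson Γ V ρ ν P)
    (hα0 : 0 < α) (hp : α < p) (hp2 : p ≤ 2) (hf : Measurable f)
    (hfp : Integrable (fun x => |f x| ^ p) ν) :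
    ∀ᵐ ω ∂P, ∃ l, Tendsto
      (fun n => ∑ k ∈ Finset.range n, ρ k ω * Γ k ω ^ (-(1 / α)) * f (V k ω)) atTop (𝓝 l) := by
  have hC : MeasurableSet {z : (ℕ → ℝ) × (ℕ → X × ℝ) | ∃ l, Tendsto
      (fun n => ∑ k ∈ Finset.range n, (z.2 k).2 * z.1 k ^ (-(1 / α)) * f (z.2 k).1) atTop
      (𝓝 l)} := measurableSet_exists_tendsto fun n => by fun_prop
  refine IndepFun.ae_prodMk_mem h.indep (aemeasurable_pi_lambda _ h.aemeasurable_arrival)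
    (aemeasurable_pi_lambda _ fun k => (h.hasLaw k).aemeasurable) hC ?_
  filter_upwards [h.ae_summable_arrival_rpow hα0 hp] with ω hω
  exact ae_exists_tendsto_signedSum h.iIndep h.hasLaw hf (hα0.trans hp) hp2 hfp hω

end IsSignedMarkedPoisson

/-! ### The transform of one term and its integral -/

section CosTransform

variable {X : Type*} [MeasurableSpace X] {ν : Measure X} [IsProbabilityMeasure ν] {f : X → ℝ}
  {α : ℝ}

/-- The conditional characteristic function of `ρ x^{-1/α} f(V)` at `u`. -/
def cosTransform (ν : Measure X) (f : X → ℝ) (α u x : ℝ) : ℝ :=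
  ∫ v, Real.cos (u * f v * x ^ (-(1 / α))) ∂ν

theorem measurable_cosTransform (hf : Measurable f) (u : ℝ) :
    Measurable (cosTransform ν f α u) :=
  (StronglyMeasurable.integral_prod_right (f := fun x v => Real.cos (u * f v * x ^ (-(1 / α))))
    (by fun_prop : Measurable _).stronglyMeasurable).measurable

theorem abs_cosTransform_le_one (u x : ℝ) : |cosTransform ν f α u x| ≤ 1 := by
  rw [cosTransform, ← Real.norm_eq_abs]
  refine (norm_integral_le_of_norm_le_const (C := 1)
    (Eventually.of_forall fun v => ?_)).trans ?_
  · exact Real.abs_cos_le_one _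
  · simp

theorem integrable_cos_comp {g : X → ℝ} (hg : Measurable g) :
    Integrable (fun v => Real.cos (g v)) ν :=
  Integrable.of_bound (by fun_prop : Measurable _).aestronglyMeasurable 1
    (Eventually.of_forall fun v => Real.abs_cos_le_one _)

theorem continuousOn_cosTransform (hf : Measurable f) (u : ℝ) :
    ContinuousOn (cosTransform ν f α u) (Set.Ioi 0) := by
  refine continuousOn_of_dominated (bound := fun _ => 1)
    (fun x _ => (by fun_prop : Measurable _).aestronglyMeasurable)
    (fun x _ => Eventually.of_forall fun v => Real.abs_cos_le_one _) (integrable_const 1)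
    (Eventually.of_forall fun v => ?_)
  exact Real.continuous_cos.comp_continuousOn (continuousOn_const.mul
    (ContinuousOn.rpow_const continuousOn_id fun x hx => Or.inl (ne_of_gt hx)))

theorem one_sub_cosTransform (hf : Measurable f) (u x : ℝ) :
    1 - cosTransform ν f α u x = ∫ v, (1 - Real.cos (u * f v * x ^ (-(1 / α)))) ∂ν := by
  rw [integral_sub (integrable_const 1) (integrable_cos_comp (by fun_prop)), cosTransform]
  simp

/-- Integrating in `x` first, nonnegativity of `1 - cos` makes the inner norm integral explicit: a
constant times `|f v|^α`. Joint integrability justifies the later exchange of integrals. -/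
theorem integrable_one_sub_cos_prod (hα0 : 0 < α) (hα2 : α < 2) (hf : Measurable f)
    (hfα : Integrable (fun v => |f v| ^ α) ν) (u : ℝ) :
    Integrable (fun z : ℝ × X => 1 - Real.cos (u * f z.2 * z.1 ^ (-(1 / α))))
      ((volume.restrict (Set.Ioi 0)).prod ν) := by
  rw [integrable_prod_iff' (by fun_prop : Measurable _).aestronglyMeasurable]
  refine ⟨Eventually.of_forall fun v => integrableOn_one_sub_cos_rpow hα0 hα2 (u * f v), ?_⟩
  have h : ∀ v, ∫ x in Set.Ioi (0 : ℝ), ‖1 - Real.cos (u * f v * x ^ (-(1 / α)))‖ =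
      |u| ^ α * |f v| ^ α * stableIntegral α := fun v => by
    rw [← Real.mul_rpow (abs_nonneg _) (abs_nonneg _), ← abs_mul,
      ← integral_one_sub_cos_rpow hα0]
    congr 1 with x
    exact Real.norm_of_nonneg (by linarith [Real.cos_le_one (u * f v * x ^ (-(1 / α)))])
  simp only [h]
  exact (hfα.const_mul _).mul_const _

theorem integrableOn_one_sub_cosTransform (hα0 : 0 < α) (hα2 : α < 2) (hf : Measurable f)
    (hfα : Integrable (fun v => |f v| ^ α) ν) (u : ℝ) :
    IntegrableOn (fun x => 1 - cosTransform ν f α u x) (Set.Ioi 0) := by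
  simp only [one_sub_cosTransform hf]
  exact (integrable_one_sub_cos_prod hα0 hα2 hf hfα u).integral_prod_left

theorem integral_one_sub_cosTransform (hα0 : 0 < α) (hα2 : α < 2) (hf : Measurable f)
    (hfα : Integrable (fun v => |f v| ^ α) ν) (u : ℝ) :
    ∫ x in Set.Ioi (0 : ℝ), (1 - cosTransform ν f α u x) =
      |u| ^ α * stableIntegral α * ∫ v, |f v| ^ α ∂ν := by
  simp only [one_sub_cosTransform hf]
  rw [integral_integral_swap (f := fun x v => 1 - Real.cos (u * f v * x ^ (-(1 / α))))
    (integrable_one_sub_cos_prod hα0 hα2 hf hfα u), ← integral_const_mul]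
  congr 1 with v
  rw [integral_one_sub_cos_rpow hα0, abs_mul, Real.mul_rpow (abs_nonneg _) (abs_nonneg _)]
  ring

/-- The mean of `e^{iθ}` and `e^{-iθ}` is `cos θ`; the transform is therefore real, and the product
functional is needed only for real `G`. -/
theorem integral_cexp_prod_fairSign (hf : Measurable f) (u x : ℝ) :
    ∫ z, Complex.exp ((u * (z.2 * x ^ (-(1 / α)) * f z.1) : ℝ) * Complex.I)
      ∂(ν.prod fairSign) = (cosTransform ν f α u x : ℂ) := by
  have hint : ∀ g : X → ℝ, Measurable g →
      Integrable (fun v => Complex.exp ((g v : ℝ) * Complex.I)) ν := fun g hg =>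
    Integrable.of_bound (by fun_prop : Measurable _).aestronglyMeasurable 1
      (Eventually.of_forall fun v => (Complex.norm_exp_ofReal_mul_I _).le)
  rw [integral_prod_fairSign
    (h := fun z => Complex.exp ((u * (z.2 * x ^ (-(1 / α)) * f z.1) : ℝ) * Complex.I))
    (by fun_prop : Measurable _).stronglyMeasurable (hint _ (by fun_prop))
    (hint _ (by fun_prop)), ← integral_add (hint _ (by fun_prop)) (hint _ (by fun_prop)),
    ← integral_smul, cosTransform, ← integral_complex_ofReal]
  congr 1 with v
  have e1 : u * (1 * x ^ (-(1 / α)) * f v) = u * f v * x ^ (-(1 / α)) := by ring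
  have e2 : u * (-1 * x ^ (-(1 / α)) * f v) = -(u * f v * x ^ (-(1 / α))) := by ring
  rw [e1, e2, Complex.ofReal_cos, Complex.cos, Complex.real_smul]
  push_cast
  rw [inv_mul_eq_div]

end CosTransform

/-! ### Characteristic functions of the partial sums -/

namespace IsSignedMarkedPoisson

variable {Ω : Type*} [MeasurableSpace Ω] {P : Measure Ω} [IsProbabilityMeasure P]
  {X : Type*} [MeasurableSpace X] {ν : Measure X} [IsProbabilityMeasure ν]
  {Γ : ℕ → Ω → ℝ} {V : ℕ → Ω → X} {ρ : ℕ → Ω → ℝ} {f : X → ℝ} {α p : ℝ}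

/-- For frozen arrival times the terms are independent, so the expectation over the marks is a
product of one-term transforms. -/
theorem integral_cexp_sum (h : IsSignedMarkedPoisson Γ V ρ ν P) (hf : Measurable f) (u : ℝ)
    (n : ℕ) :
    ∫ ω, Complex.exp ((u * ∑ k ∈ Finset.range n, ρ k ω * Γ k ω ^ (-(1 / α)) * f (V k ω) : ℝ) *
      Complex.I) ∂P = ((∫ ω, ∏ k ∈ Finset.range n, cosTransform ν f α u (Γ k ω) ∂P : ℝ) : ℂ) := by
  have hWm := aemeasurable_pi_lambda (fun ω k => (V k ω, ρ k ω))
    fun k => (h.hasLaw k).aemeasurable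
  have hΓm := aemeasurable_pi_lambda (fun ω k => Γ k ω) h.aemeasurable_arrival
  have hΦ : Measurable fun z : (ℕ → ℝ) × (ℕ → X × ℝ) => Complex.exp
      ((u * ∑ k ∈ Finset.range n, (z.2 k).2 * z.1 k ^ (-(1 / α)) * f (z.2 k).1 : ℝ) *
        Complex.I) := by fun_prop
  have key := IndepFun.integral_comp_prodMk h.indep hΓm hWm hΦ.stronglyMeasurable
    (Integrable.of_bound (hΦ.comp_aemeasurable (hΓm.prodMk hWm)).aestronglyMeasurable 1
      (Eventually.of_forall fun ω => (Complex.norm_exp_ofReal_mul_I _).le))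
  refine key.trans ?_
  rw [← integral_complex_ofReal]
  congr 1 with ω
  refine (integral_map hWm (hΦ.comp
    (measurable_prodMk_left (x := fun k => Γ k ω))).aestronglyMeasurable).trans ?_
  have hg : ∀ k : Fin n, Measurable fun z : X × ℝ =>
      Complex.exp ((u * (z.2 * Γ k ω ^ (-(1 / α)) * f z.1) : ℝ) * Complex.I) :=
    fun k => by fun_prop
  have hprod := (h.iIndep.precomp (g := ((↑) : Fin n → ℕ)) Fin.val_injective).integral_fun_prod_comp
    (fun k => (h.hasLaw k).aemeasurable) (fun k => (hg k).aestronglyMeasurable)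
  have hone : ∀ k : Fin n, ∫ ω', Complex.exp
      ((u * (ρ k ω' * Γ k ω ^ (-(1 / α)) * f (V k ω')) : ℝ) * Complex.I) ∂P =
      (cosTransform ν f α u (Γ k ω) : ℂ) := fun k =>
    ((h.hasLaw k).integral_comp (hg k).aestronglyMeasurable).trans
      (integral_cexp_prod_fairSign hf u _)
  rw [Finset.prod_range]
  push_cast
  refine Eq.trans ?_ (hprod.trans (Finset.prod_congr rfl fun k _ => hone k))
  congr 1 with ω'
  rw [← Complex.exp_sum]
  simp only [Function.comp_apply, Finset.sum_range]
  push_cast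
  rw [Finset.mul_sum, Finset.sum_mul]

theorem tendsto_integral_cexp_sum (h : IsSignedMarkedPoisson Γ V ρ ν P) (hα0 : 0 < α)
    (hα2 : α < 2) (hf : Measurable f) (hfα : Integrable (fun v => |f v| ^ α) ν) (u : ℝ) :
    Tendsto (fun n => ∫ ω, Complex.exp
      ((u * ∑ k ∈ Finset.range n, ρ k ω * Γ k ω ^ (-(1 / α)) * f (V k ω) : ℝ) * Complex.I) ∂P)
      atTop (𝓝 (Real.exp (-(|u| ^ α * stableIntegral α * ∫ v, |f v| ^ α ∂ν)) : ℝ)) := by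
  obtain ⟨τ, hind, hlaw, hΓ⟩ := h.arrival
  have key := tendsto_integral_prod_arrivalTime hind hlaw (measurable_cosTransform hf u)
    (abs_cosTransform_le_one (ν := ν) (f := f) (α := α) u) (continuousOn_cosTransform hf u)
    (integrableOn_one_sub_cosTransform hα0 hα2 hf hfα u)
  rw [integral_one_sub_cosTransform hα0 hα2 hf hfα] at key
  simp only [h.integral_cexp_sum hf]
  refine ((Complex.continuous_ofReal.tendsto _).comp key).congr fun n => ?_
  refine congrArg _ (integral_congr_ae ?_)
  filter_upwards [ae_all_iff.2 hΓ] with ω hω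
  simp only [hω]

end IsSignedMarkedPoisson

/-! ### Estimates from a symmetric stable characteristic function -/

section SymmetricStable

variable {Ω : Type*} [MeasurableSpace Ω] {P : Measure Ω}

/-- The real random variable `Z` has characteristic function `exp(-s |t|^α)`. -/
def HasSymmetricStableCharFun (Z : Ω → ℝ) (α s : ℝ) (P : Measure Ω) : Prop :=
  AEMeasurable Z P ∧ ∀ t : ℝ, charFun (P.map Z) t = (Real.exp (-(|t| ^ α * s)) : ℂ)

namespace HasSymmetricStableCharFun

variable {Z : Ω → ℝ} {α s : ℝ}

theorem congr {Z' : Ω → ℝ} (h : HasSymmetricStableCharFun Z α s P) (hZ : Z =ᵐ[P] Z') :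
    HasSymmetricStableCharFun Z' α s P :=
  ⟨h.1.congr hZ, fun t => by rw [← Measure.map_congr hZ, h.2]⟩

variable [IsProbabilityMeasure P]

/-- The truncation inequality bounds the tail by the integral of `1 - φ` over `[-2/r, 2/r]`, where
`1 - e^{-y} ≤ y` applies. The bound is linear in `s`, so it serves both for limits in probability
and for Borel–Cantelli. -/
theorem measureReal_lt_abs_le (h : HasSymmetricStableCharFun Z α s P) (hα0 : 0 < α)
    (hs : 0 ≤ s) {r : ℝ} (hr : 0 < r) :
    P.real {ω | r < |Z ω|} ≤ 2 * (2 * r⁻¹) ^ α * s := by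
  have := Measure.isProbabilityMeasure_map h.1
  have hset : MeasurableSet {x : ℝ | r < |x|} := measurableSet_lt measurable_const measurable_norm
  have h1 := measureReal_abs_gt_le_integral_charFun (μ := P.map Z) hr
  rw [map_measureReal_apply_of_aemeasurable h.1 hset] at h1
  have hr' : 0 < r⁻¹ := inv_pos.2 hr
  have h2 : ‖∫ t in -2 * r⁻¹..2 * r⁻¹, 1 - charFun (P.map Z) t‖ ≤
      (2 * r⁻¹) ^ α * s * |2 * r⁻¹ - -2 * r⁻¹| := by
    refine intervalIntegral.norm_integral_le_of_norm_le_const fun t ht => ?_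
    rw [Set.uIoc_of_le (by linarith)] at ht
    have ht' : |t| ≤ 2 * r⁻¹ := abs_le.2 ⟨by linarith [ht.1], ht.2⟩
    have h3 : |t| ^ α * s ≤ (2 * r⁻¹) ^ α * s :=
      mul_le_mul_of_nonneg_right (Real.rpow_le_rpow (abs_nonneg t) ht' hα0.le) hs
    have h4 : 0 ≤ |t| ^ α * s := mul_nonneg (Real.rpow_nonneg (abs_nonneg t) _) hs
    rw [h.2, ← Complex.ofReal_one, ← Complex.ofReal_sub, Complex.norm_real, Real.norm_of_nonneg]
    · linarith [Real.one_sub_le_exp_neg (|t| ^ α * s)]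
    · linarith [Real.exp_le_one_iff.2 (neg_nonpos.2 h4)]
  refine h1.trans ((mul_le_mul_of_nonneg_left h2 (by positivity)).trans (le_of_eq ?_))
  rw [abs_of_pos (by linarith)]
  field_simp
  ring

theorem map_neg_eq (h : HasSymmetricStableCharFun Z α s P) :
    P.map (fun ω => -Z ω) = P.map Z := by
  have := Measure.isProbabilityMeasure_map h.1
  have := Measure.isProbabilityMeasure_map h.1.neg
  refine Measure.ext_of_charFun ?_
  ext t
  have hm : P.map (fun ω => -Z ω) = (P.map Z).map fun x => -1 * x := by
    rw [AEMeasurable.map_map_of_aemeasurable (by fun_prop) h.1]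
    simp [Function.comp_def]
  rw [hm, charFun_map_mul, h.2, h.2]
  simp

theorem neg (h : HasSymmetricStableCharFun Z α s P) :
    HasSymmetricStableCharFun (fun ω => -Z ω) α s P :=
  ⟨h.1.neg, fun t => by rw [h.map_neg_eq, h.2]⟩

theorem integral_truncOne (h : HasSymmetricStableCharFun Z α s P) :
    ∫ ω, truncOne (Z ω) ∂P = 0 := by
  have h1 := integral_map (f := truncOne) h.1 measurable_truncOne.aestronglyMeasurable
  have h2 := integral_map (f := truncOne) h.1.neg measurable_truncOne.aestronglyMeasurable
  have h3 : P.map (-Z) = P.map Z := h.map_neg_eq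
  rw [h3, h1] at h2
  simp only [Pi.neg_apply, truncOne_neg, integral_neg] at h2
  linarith

theorem truncOne_sq_le_one_sub_cos (x : ℝ) : truncOne x ^ 2 ≤ 5 * (1 - Real.cos x) := by
  unfold truncOne
  split_ifs with h
  · have h1 := Real.cos_le_one_sub_mul_cos_sq (h.trans (by linarith [Real.pi_gt_three]))
    -- The constant `5` comes from `cos x ≤ 1 - (2/π²) x²` on `[-π, π]` and `π² < 10`.
    have h2 : (1 : ℝ) / 5 ≤ 2 / Real.pi ^ 2 := by
      rw [div_le_div_iff₀ (by norm_num) (by positivity)]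
      nlinarith [Real.pi_lt_d2, Real.pi_pos]
    nlinarith [mul_le_mul_of_nonneg_right h2 (sq_nonneg x)]
  · nlinarith [Real.cos_le_one x]

theorem integral_cos (h : HasSymmetricStableCharFun Z α s P) :
    ∫ ω, Real.cos (Z ω) ∂P = Real.exp (-s) := by
  have h1 := h.2 1
  rw [charFun_apply_real, integral_map h.1 (by fun_prop : Measurable _).aestronglyMeasurable] at h1
  have hi : Integrable (fun ω => Complex.exp ((1 : ℝ) * (Z ω) * Complex.I)) P := by
    refine Integrable.of_bound (C := 1) ?_ (Eventually.of_forall fun ω => ?_)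
    · have := h.1
      exact (by fun_prop : AEMeasurable _ P).aestronglyMeasurable
    · rw [← Complex.ofReal_mul, Complex.norm_exp_ofReal_mul_I]
  have h2 := congrArg Complex.re h1
  have h3 := integral_re hi
  simp only [RCLike.re_to_complex] at h3
  rw [← h3] at h2
  simpa [Complex.exp_re] using h2

/-- The truncated square is dominated by `1 - cos Z`, whose mean is read off from the characteristic
function at `1`; no moment of `Z` is required. -/
theorem integral_truncOne_sq_le (h : HasSymmetricStableCharFun Z α s P) :
    ∫ ω, truncOne (Z ω) ^ 2 ∂P ≤ 5 * s := by
  have hc : Integrable (fun ω => Real.cos (Z ω)) P :=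
    Integrable.of_bound (Real.continuous_cos.measurable.comp_aemeasurable h.1).aestronglyMeasurable
      1 (Eventually.of_forall fun ω => Real.abs_cos_le_one _)
  calc ∫ ω, truncOne (Z ω) ^ 2 ∂P ≤ ∫ ω, 5 * (1 - Real.cos (Z ω)) ∂P :=
        integral_mono (integrable_truncOne_comp_sq h.1)
          (((integrable_const 1).sub hc).const_mul 5) fun ω => truncOne_sq_le_one_sub_cos _
    _ = 5 * (1 - Real.exp (-s)) := by
        rw [integral_const_mul, integral_sub (integrable_const 1) hc, h.integral_cos]
        simp
    _ ≤ 5 * s := by linarith [Real.one_sub_le_exp_neg s]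

end HasSymmetricStableCharFun

variable [IsProbabilityMeasure P] {α : ℝ}

theorem tendstoInMeasure_of_hasSymmetricStableCharFun {Z : ℕ → Ω → ℝ} {Z₀ : Ω → ℝ} {s : ℕ → ℝ}
    (h : ∀ n, HasSymmetricStableCharFun (fun ω => Z n ω - Z₀ ω) α (s n) P) (hα0 : 0 < α)
    (hs : ∀ n, 0 ≤ s n) (hlim : Tendsto s atTop (𝓝 0)) : TendstoInMeasure P Z atTop Z₀ := by
  refine tendstoInMeasure_iff_measureReal_norm.2 fun ε hε => ?_
  -- The tail bound is for a strict inequality and convergence in measure uses a weak one, hence the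
  -- level `ε / 2`.
  have h0 : Tendsto (fun n => 2 * (2 * (ε / 2)⁻¹) ^ α * s n) atTop (𝓝 0) := by
    simpa using hlim.const_mul (2 * (2 * (ε / 2)⁻¹) ^ α)
  refine squeeze_zero (fun n => measureReal_nonneg) (fun n => ?_) h0
  refine le_trans (measureReal_mono fun ω hω => ?_)
    ((h n).measureReal_lt_abs_le hα0 (hs n) (half_pos hε))
  exact (half_lt_self hε).trans_le hω

/-- Independent symmetric stable summands with summable scales (raised to the power `α`) have an
almost surely convergent sum. -/
theorem ae_exists_tendsto_sum_of_hasSymmetricStableCharFun {Z : ℕ → Ω → ℝ} {s : ℕ → ℝ}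
    (h : ∀ n, HasSymmetricStableCharFun (Z n) α (s n) P) (hind : iIndepFun Z P) (hα0 : 0 < α)
    (hs : ∀ n, 0 ≤ s n) (hsum : Summable s) :
    ∀ᵐ ω ∂P, ∃ l, Tendsto (fun n => ∑ k ∈ Finset.range n, Z k ω) atTop (𝓝 l) :=
  ae_exists_tendsto_sum_of_truncOne (fun k => (h k).1) hind
    ((hsum.mul_left _).of_nonneg_of_le (fun _ => measureReal_nonneg)
      fun k => (h k).measureReal_lt_abs_le hα0 (hs k) one_pos)
    (fun k => (h k).integral_truncOne)
    ((hsum.mul_left 5).of_nonneg_of_le (fun _ => integral_nonneg fun _ => sq_nonneg _)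
      fun k => (h k).integral_truncOne_sq_le)

end SymmetricStable

instance isProbabilityMeasure_fairSign : IsProbabilityMeasure fairSign := by
  refine ⟨?_⟩
  simp [fairSign, ENNReal.inv_two_add_inv_two]

/-! ### Linearity of the series in the integrand -/

section LinearCombination

variable {Ω X ι : Type*} {α v : ℝ} {Γ : ℕ → Ω → ℝ} {V : ℕ → Ω → X} {ρ : ℕ → Ω → ℝ}

theorem tendsto_seriesSum_of_tendsto {f : X → ℝ} {ω : Ω} {l : ℝ}
    (h : Tendsto (fun n => seriesPartialSum α v Γ V ρ f n ω) atTop (𝓝 l)) :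
    seriesSum α v Γ V ρ f ω = l :=
  h.limUnder_eq

theorem seriesPartialSum_sum (s : Finset ι) (c : ι → ℝ) (f : ι → X → ℝ) (n : ℕ) (ω : Ω) :
    seriesPartialSum α v Γ V ρ (fun x => ∑ i ∈ s, c i * f i x) n ω =
      ∑ i ∈ s, c i * seriesPartialSum α v Γ V ρ (f i) n ω := by
  simp only [seriesPartialSum, Finset.mul_sum]
  rw [Finset.sum_comm]
  refine Finset.sum_congr rfl fun i _ => Finset.sum_congr rfl fun k _ => ?_
  ring

theorem seriesPartialSum_sub (f g : X → ℝ) (n : ℕ) (ω : Ω) :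
    seriesPartialSum α v Γ V ρ (fun x => f x - g x) n ω =
      seriesPartialSum α v Γ V ρ f n ω - seriesPartialSum α v Γ V ρ g n ω := by
  simp only [seriesPartialSum, mul_sub, Finset.sum_sub_distrib]

/-- `seriesSum` has an arbitrary value where the series diverges, so linearity holds only at points
of convergence and is used almost surely. -/
theorem seriesSum_sum {s : Finset ι} (c : ι → ℝ) {f : ι → X → ℝ} {ω : Ω}
    (h : ∀ i ∈ s, Tendsto (fun n => seriesPartialSum α v Γ V ρ (f i) n ω) atTop
      (𝓝 (seriesSum α v Γ V ρ (f i) ω))) :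
    seriesSum α v Γ V ρ (fun x => ∑ i ∈ s, c i * f i x) ω =
      ∑ i ∈ s, c i * seriesSum α v Γ V ρ (f i) ω := by
  refine tendsto_seriesSum_of_tendsto ?_
  simp only [seriesPartialSum_sum]
  exact tendsto_finsetSum _ fun i hi => (h i hi).const_mul _

theorem seriesSum_sub {f g : X → ℝ} {ω : Ω}
    (hf : Tendsto (fun n => seriesPartialSum α v Γ V ρ f n ω) atTop
      (𝓝 (seriesSum α v Γ V ρ f ω)))
    (hg : Tendsto (fun n => seriesPartialSum α v Γ V ρ g n ω) atTop
      (𝓝 (seriesSum α v Γ V ρ g ω))) :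
    seriesSum α v Γ V ρ (fun x => f x - g x) ω =
      seriesSum α v Γ V ρ f ω - seriesSum α v Γ V ρ g ω := by
  refine tendsto_seriesSum_of_tendsto ?_
  simp only [seriesPartialSum_sub]
  exact hf.sub hg

end LinearCombination

theorem integrable_abs_rpow_of_memLp {X : Type*} [MeasurableSpace X] {ν : Measure X}
    {f : X → ℝ} {p : ℝ} (hp : 0 < p) (hf : MemLp f (ENNReal.ofReal p) ν) :
    Integrable (fun x => |f x| ^ p) ν := by
  have h := hf.integrable_norm_rpow (by simpa using hp) ENNReal.ofReal_ne_top
  simpa only [ENNReal.toReal_ofReal hp.le, Real.norm_eq_abs] using h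

/-! ### The law of the sum -/

namespace IsSignedMarkedPoisson

variable {Ω : Type*} [MeasurableSpace Ω] {P : Measure Ω}
  {X : Type*} [MeasurableSpace X] {ν : Measure X}
  {Γ : ℕ → Ω → ℝ} {V : ℕ → Ω → X} {ρ : ℕ → Ω → ℝ} {f g : X → ℝ} {α p v : ℝ}

theorem hasLaw_point [SFinite ν] (h : IsSignedMarkedPoisson Γ V ρ ν P) (k : ℕ) : HasLaw (V k) ν P := by
  refine ⟨measurable_fst.comp_aemeasurable (h.hasLaw k).aemeasurable, ?_⟩
  have h1 := AEMeasurable.map_map_of_aemeasurable (g := Prod.fst) (by fun_prop)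
    (h.hasLaw k).aemeasurable
  rw [(h.hasLaw k).map_eq, Measure.map_fst_prod, measure_univ, one_smul] at h1
  exact h1.symm

/-- The points `V_k` are countably many and each has law `ν`, so almost surely all of them avoid a
given null set; `f` may then be replaced by a measurable version. -/
theorem ae_forall_seriesPartialSum_eq [SFinite ν] (h : IsSignedMarkedPoisson Γ V ρ ν P) (hfg : f =ᵐ[ν] g) :
    ∀ᵐ ω ∂P, ∀ n, seriesPartialSum α v Γ V ρ f n ω = seriesPartialSum α v Γ V ρ g n ω := by
  have h1 : ∀ᵐ ω ∂P, ∀ k, f (V k ω) = g (V k ω) := by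
    refine ae_all_iff.2 fun k => ?_
    rw [← (h.hasLaw_point k).map_eq] at hfg
    exact ae_of_ae_map (h.hasLaw_point k).aemeasurable hfg
  filter_upwards [h1] with ω hω n
  simp only [seriesPartialSum, hω]

theorem aemeasurable_seriesPartialSum [SFinite ν] (h : IsSignedMarkedPoisson Γ V ρ ν P)
    (hf : AEMeasurable f ν) (n : ℕ) :
    AEMeasurable (fun ω => seriesPartialSum α v Γ V ρ f n ω) P := by
  have hV : ∀ k, AEMeasurable (fun ω => f (V k ω)) P := fun k => by
    rw [← (h.hasLaw_point k).map_eq] at hf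
    exact hf.comp_aemeasurable (h.hasLaw_point k).aemeasurable
  have hρ : ∀ k, AEMeasurable (ρ k) P := fun k =>
    measurable_snd.comp_aemeasurable (h.hasLaw k).aemeasurable
  exact (Finset.aemeasurable_fun_sum _ fun k _ =>
    ((hρ k).mul ((h.aemeasurable_arrival k).pow_const _)).mul (hV k)).const_mul _

variable [IsProbabilityMeasure P] [IsProbabilityMeasure ν]

/-- Almost sure convergence of the series. -/
theorem ae_tendsto_seriesSum (h : IsSignedMarkedPoisson Γ V ρ ν P) (hα0 : 0 < α)
    (hp : α < p) (hp2 : p ≤ 2) (hf : MemLp f (ENNReal.ofReal p) ν) :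
    ∀ᵐ ω ∂P, Tendsto (fun n => seriesPartialSum α v Γ V ρ f n ω) atTop
      (𝓝 (seriesSum α v Γ V ρ f ω)) := by
  have hae := hf.aestronglyMeasurable.aemeasurable.ae_eq_mk
  have hm := hf.aestronglyMeasurable.aemeasurable.measurable_mk
  filter_upwards [h.ae_forall_seriesPartialSum_eq (α := α) (v := v) hae,
    h.ae_exists_tendsto hα0 hp hp2 hm
      (integrable_abs_rpow_of_memLp (hα0.trans hp) ((memLp_congr_ae hae).1 hf))]
    with ω h1 ⟨l, hl⟩
  refine tendsto_nhds_limUnder ⟨(stableConst α * v) ^ (1 / α) * l, ?_⟩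
  simp only [h1]
  exact hl.const_mul _

/-- The sum of the series is symmetric stable, with scale the `L^α` norm of `f`. -/
theorem hasSymmetricStableCharFun_seriesSum (h : IsSignedMarkedPoisson Γ V ρ ν P) (hα0 : 0 < α)
    (hα2 : α < 2) (hp : α < p) (hp2 : p ≤ 2) (hv : 0 ≤ v)
    (hf : MemLp f (ENNReal.ofReal p) ν) :
    HasSymmetricStableCharFun (seriesSum α v Γ V ρ f) α (v * ∫ x, |f x| ^ α ∂ν) P := by
  have hconv := h.ae_tendsto_seriesSum (v := v) hα0 hp hp2 hf
  have hSm : AEMeasurable (seriesSum α v Γ V ρ f) P :=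
    aemeasurable_of_tendsto_metrizable_ae atTop
      (fun n => h.aemeasurable_seriesPartialSum hf.aestronglyMeasurable.aemeasurable n) hconv
  refine ⟨hSm, fun t => ?_⟩
  rw [charFun_apply_real, integral_map hSm (by fun_prop : Measurable _).aestronglyMeasurable]
  set f' := hf.aestronglyMeasurable.aemeasurable.mk f with hf'
  have hae : f =ᵐ[ν] f' := hf.aestronglyMeasurable.aemeasurable.ae_eq_mk
  have hm : Measurable f' := hf.aestronglyMeasurable.aemeasurable.measurable_mk
  have hfα : MemLp f' (ENNReal.ofReal α) ν :=
    ((memLp_congr_ae hae).1 hf).mono_exponent (ENNReal.ofReal_le_ofReal hp.le)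
  -- The normalising factor is absorbed into the frequency; raised to the power `α` it becomes `C_α
  -- v`, and `C_α` cancels `stableIntegral α`.
  have h1 := h.tendsto_integral_cexp_sum hα0 hα2 hm (integrable_abs_rpow_of_memLp hα0 hfα)
    (t * (stableConst α * v) ^ (1 / α))
  have h2 : Tendsto (fun n => ∫ ω, Complex.exp (t * seriesPartialSum α v Γ V ρ f n ω *
      Complex.I) ∂P) atTop (𝓝 (∫ ω, Complex.exp (t * seriesSum α v Γ V ρ f ω *
      Complex.I) ∂P)) := by
    refine tendsto_integral_of_dominated_convergence (fun _ => 1) (fun n => ?_)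
      (integrable_const _) (fun n => Eventually.of_forall fun ω => ?_) ?_
    · have := h.aemeasurable_seriesPartialSum (α := α) (v := v)
        hf.aestronglyMeasurable.aemeasurable n
      exact (by fun_prop : AEMeasurable _ P).aestronglyMeasurable
    · rw [← Complex.ofReal_mul, Complex.norm_exp_ofReal_mul_I]
    · filter_upwards [hconv] with ω hω
      exact (((Complex.continuous_ofReal.tendsto _).comp hω).const_mul _).mul_const _ |>.cexp
  refine tendsto_nhds_unique h2 ?_
  have h3 : |t * (stableConst α * v) ^ (1 / α)| ^ α * stableIntegral α * ∫ x, |f' x| ^ α ∂ν =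
      |t| ^ α * (v * ∫ x, |f x| ^ α ∂ν) := by
    have hK := stableIntegral_pos hα0 hα2
    have hc : 0 ≤ stableConst α * v := by
      rw [stableConst_eq hα0 hα2]
      positivity
    have hI : ∫ x, |f x| ^ α ∂ν = ∫ x, |f' x| ^ α ∂ν :=
      integral_congr_ae (hae.mono fun x hx => congrArg (fun y => |y| ^ α) hx)
    rw [hI, abs_mul, Real.mul_rpow (abs_nonneg _) (abs_nonneg _),
      abs_of_nonneg (Real.rpow_nonneg hc _), ← Real.rpow_mul hc, one_div_mul_cancel hα0.ne',
      Real.rpow_one, stableConst_eq hα0 hα2]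
    field_simp
  rw [h3] at h1
  refine h1.congr fun n => integral_congr_ae ?_
  filter_upwards [h.ae_forall_seriesPartialSum_eq (α := α) (v := v) hae] with ω hω
  rw [hω, seriesPartialSum]
  push_cast
  ring_nf

end IsSignedMarkedPoisson

theorem indicator_image_val {X : Type*} {E : Set X} {A : Set E} (x : E) :
    (Subtype.val '' A).indicator (fun _ => (1 : ℝ)) x = A.indicator (fun _ => 1) x := by
  by_cases hx : x ∈ A
  · rw [Set.indicator_of_mem hx, Set.indicator_of_mem (Set.mem_image_of_mem _ hx)]
  · rw [Set.indicator_of_notMem hx, Set.indicator_of_notMem]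
    rintro ⟨y, hy, hyx⟩
    exact hx (Subtype.val_injective hyx ▸ hy)

theorem indicator_image_val_diff {X : Type*} {E : Set X} {A B : Set E} (hBA : B ⊆ A) :
    ((Subtype.val '' (A \ B)).indicator fun _ => (1 : ℝ)) = fun x =>
      (Subtype.val '' A).indicator (fun _ => 1) x -
        (Subtype.val '' B).indicator (fun _ => 1) x := by
  rw [Set.image_sdiff Subtype.val_injective, Set.indicator_sdiff (Set.image_mono hBA)]
  rfl

/-! ### Passing between `E` as a subtype and as a subset -/

section Subtype

variable {X : Type*} [MeasurableSpace X] {m : Measure X} {E : Set X}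

/-- `E` is only null measurable, so the inclusion need not be a measurable embedding; the images of
measurable sets are still null measurable, which suffices. -/
theorem map_val_comap_val (hE : NullMeasurableSet E m) :
    (m.comap (Subtype.val : E → X)).map Subtype.val = m.restrict E := by
  ext B hB
  rw [Measure.map_apply measurable_subtype_coe hB, Measure.restrict_apply hB,
    Measure.comap_apply₀ _ _ Subtype.val_injective
      (fun s hs => Measure.MeasurableSet.nullMeasurableSet_subtype_coe hE hs)
      (measurable_subtype_coe hB).nullMeasurableSet, Subtype.image_preimage_coe,
    Set.inter_comm]

theorem integral_comap_val {f : X → ℝ} (hE : NullMeasurableSet E m)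
    (hf : AEStronglyMeasurable f (m.restrict E)) :
    ∫ x : E, f x ∂(m.comap Subtype.val) = ∫ x in E, f x ∂m := by
  rw [← map_val_comap_val hE] at hf ⊢
  rw [integral_map measurable_subtype_coe.aemeasurable hf]

theorem memLp_comap_val {f : X → ℝ} {p : ℝ≥0∞} (hE : NullMeasurableSet E m)
    (hf : MemLp f p (m.restrict E)) : MemLp (fun x : E => f x) p (m.comap Subtype.val) := by
  rw [← map_val_comap_val hE] at hf
  exact hf.comp_of_map measurable_subtype_coe.aemeasurable

theorem isFiniteMeasure_comap_val (hE : NullMeasurableSet E m) (hE1 : m E < ∞) :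
    IsFiniteMeasure (m.comap (Subtype.val : E → X)) := by
  refine ⟨?_⟩
  rw [← Set.preimage_univ (f := (Subtype.val : E → X)),
    ← Measure.map_apply measurable_subtype_coe MeasurableSet.univ, map_val_comap_val hE]
  simpa using hE1

theorem memLp_indicator_image {A : Set E} {p : ℝ≥0∞} (hE : NullMeasurableSet E m)
    (hE1 : m E < ∞) (hA : MeasurableSet A) :
    MemLp ((Subtype.val '' A).indicator fun _ => (1 : ℝ)) p (m.restrict E) := by
  have : IsFiniteMeasure (m.restrict E) := ⟨by simpa using hE1⟩
  have hA' : NullMeasurableSet (Subtype.val '' A) (m.restrict E) :=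
    (Measure.MeasurableSet.nullMeasurableSet_subtype_coe hE hA).mono_ac Measure.restrict_le_self.absolutelyContinuous
  refine MemLp.of_bound (aemeasurable_const.indicator₀ hA').aestronglyMeasurable 1
    (Eventually.of_forall fun x => ?_)
  by_cases hx : x ∈ Subtype.val '' A
  · simp [Set.indicator_of_mem hx]
  · simp [Set.indicator_of_notMem hx]

/-- By disjointness at most one summand is nonzero at each point, so the power passes through the
sum; off all the sets `0 ^ α = 0` is needed. -/
theorem integral_abs_sum_indicator_rpow {ι : Type*} [Fintype ι] {μ : Measure E}
    [IsFiniteMeasure μ] {A : ι → Set E} (hA : ∀ i, MeasurableSet (A i))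
    (hd : Pairwise (Function.onFun Disjoint A)) (c : ι → ℝ) {α : ℝ} (hα : α ≠ 0) :
    ∫ x, |∑ i, c i * (Subtype.val '' A i).indicator (fun _ => 1) (x : X)| ^ α ∂μ =
      ∑ i, |c i| ^ α * μ.real (A i) := by
  have h : ∀ x : E, |∑ i, c i * (Subtype.val '' A i).indicator (fun _ => 1) (x : X)| ^ α =
      ∑ i, |c i| ^ α * (A i).indicator (fun _ => 1) x := by
    intro x
    simp only [indicator_image_val]
    by_cases hx : ∃ i, x ∈ A i
    · obtain ⟨i, hi⟩ := hx
      have hj : ∀ j, j ≠ i → x ∉ A j := fun j hji hxj =>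
        Set.disjoint_left.1 (hd hji) hxj hi
      rw [Finset.sum_eq_single i (fun j _ hji => by simp [hj j hji]) (by simp),
        Finset.sum_eq_single i (fun j _ hji => by simp [hj j hji]) (by simp)]
      simp [hi]
    · push Not at hx
      simp [hx, Real.zero_rpow hα]
  simp only [h]
  rw [integral_finsetSum]
  · refine Finset.sum_congr rfl fun i _ => ?_
    rw [integral_const_mul, integral_indicator_const _ (hA i), smul_eq_mul, mul_one]
  · exact fun i _ => ((integrable_const (1 : ℝ)).indicator (hA i)).const_mul _

theorem sum_range_mul_indicator (g : SimpleFunc E ℝ) (x : E) :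
    ∑ y ∈ g.range, y * (Subtype.val '' (g ⁻¹' {y})).indicator (fun _ => 1) (x : X) = g x := by
  simp only [indicator_image_val]
  rw [Finset.sum_eq_single (g x)]
  · simp
  · intro y _ hy
    rw [Set.indicator_of_notMem, mul_zero]
    exact fun h => hy (by simpa using h.symm)
  · simp

end Subtype

theorem tendsto_integral_rpow_of_tendsto_eLpNorm {X : Type*} [MeasurableSpace X] {μ : Measure X}
    {α : ℝ} (hα0 : 0 < α) {f : ℕ → X → ℝ} (hf : ∀ k, MemLp (f k) (ENNReal.ofReal α) μ)
    (h : Tendsto (fun k => eLpNorm (f k) (ENNReal.ofReal α) μ) atTop (𝓝 0)) :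
    Tendsto (fun k => ∫ x, |f k x| ^ α ∂μ) atTop (𝓝 0) := by
  have h1 : ∀ k, ((eLpNorm (f k) (ENNReal.ofReal α) μ).toReal) ^ α = ∫ x, |f k x| ^ α ∂μ := by
    intro k
    have hnn : 0 ≤ ∫ x, |f k x| ^ α ∂μ :=
      integral_nonneg fun x => Real.rpow_nonneg (abs_nonneg _) _
    rw [(hf k).eLpNorm_eq_integral_rpow_norm (by simpa using hα0) ENNReal.ofReal_ne_top]
    simp only [ENNReal.toReal_ofReal hα0.le, Real.norm_eq_abs]
    rw [ENNReal.toReal_ofReal (Real.rpow_nonneg hnn _), ← Real.rpow_mul hnn,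
      inv_mul_cancel₀ hα0.ne', Real.rpow_one]
  simp only [← h1]
  have h2 := (ENNReal.tendsto_toReal ENNReal.zero_ne_top).comp h
  have h3 := h2.rpow_const (p := α) (Or.inr hα0.le)
  simpa [Real.zero_rpow hα0.ne'] using h3

theorem HasSymmetricStableCharFun.hasStableLaw {Ω : Type*} [MeasurableSpace Ω] {P : Measure Ω}
    {Z : Ω → ℝ} {α s : ℝ} (h : HasSymmetricStableCharFun Z α s P) (hα0 : 0 < α) (hs : 0 ≤ s) :
    HasStableLaw Z α (s ^ (1 / α)) 0 0 P := by
  refine ⟨h.1, fun t => ?_⟩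
  rw [h.2, stableCharFun]
  split_ifs with hα
  · subst hα
    simp [mul_comm]
  · rw [← Real.rpow_mul hs, one_div_mul_cancel hα0.ne', Real.rpow_one]
    simp [mul_comm]

/-! ### The stable random measure and its integral -/

namespace IsSignedMarkedPoisson

variable {Ω : Type*} [MeasurableSpace Ω] {P : Measure Ω} [IsProbabilityMeasure P]
  {X : Type*} [MeasurableSpace X] {m : Measure X} {E : Set X}
  {Γ : ℕ → Ω → ℝ} {V : ℕ → Ω → X} {ρ : ℕ → Ω → ℝ} {f : X → ℝ} {α p : ℝ}

theorem ae_tendsto_seriesSum_cond (h : IsSignedMarkedPoisson Γ V ρ (cond m E) P)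
    (hE0 : m E ≠ 0) (hE1 : m E < ∞) (hα0 : 0 < α) (hp : α < p) (hp2 : p ≤ 2)
    (hf : MemLp f (ENNReal.ofReal p) (m.restrict E)) :
    ∀ᵐ ω ∂P, Tendsto (fun n => seriesPartialSum α (m.real E) Γ V ρ f n ω) atTop
      (𝓝 (seriesSum α (m.real E) Γ V ρ f ω)) := by
  have := cond_isProbabilityMeasure_of_finite hE0 hE1.ne
  exact h.ae_tendsto_seriesSum hα0 hp hp2
    (hf.smul_measure (ENNReal.inv_ne_top.2 hE0))

theorem hasSymmetricStableCharFun_seriesSum_cond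
    (h : IsSignedMarkedPoisson Γ V ρ (cond m E) P) (hE : NullMeasurableSet E m)
    (hE0 : m E ≠ 0) (hE1 : m E < ∞) (hα0 : 0 < α) (hα2 : α < 2) (hp : α < p) (hp2 : p ≤ 2)
    (hf : MemLp f (ENNReal.ofReal p) (m.restrict E)) :
    HasSymmetricStableCharFun (seriesSum α (m.real E) Γ V ρ f) α
      (∫ x : E, |f x| ^ α ∂(m.comap Subtype.val)) P := by
  have := cond_isProbabilityMeasure_of_finite hE0 hE1.ne
  have key := h.hasSymmetricStableCharFun_seriesSum hα0 hα2 hp hp2 (v := m.real E)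
    measureReal_nonneg (hf.smul_measure (ENNReal.inv_ne_top.2 hE0))
  have hm : AEStronglyMeasurable (fun x => |f x| ^ α) (m.restrict E) :=
    (hf.aestronglyMeasurable.aemeasurable.norm.pow_const α).aestronglyMeasurable
  rw [integral_comap_val (f := fun x => |f x| ^ α) hE hm]
  -- The factor `|E|` in the normalisation cancels the density `1/|E|` of the uniform law.
  rw [ProbabilityTheory.cond, integral_smul_measure, ENNReal.toReal_inv, smul_eq_mul, ← mul_assoc,
    ← measureReal_def, mul_inv_cancel₀, one_mul] at key
  · exact key
  · exact (ENNReal.toReal_pos hE0 hE1.ne).ne'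

theorem ae_tendsto_seriesMeasure (h : IsSignedMarkedPoisson Γ V ρ (cond m E) P)
    (hE : NullMeasurableSet E m) (hE0 : m E ≠ 0) (hE1 : m E < ∞) (hα0 : 0 < α) (hα2 : α < 2)
    {A : Set E} (hA : MeasurableSet A) :
    ∀ᵐ ω ∂P, Tendsto (fun n => seriesPartialSum α (m.real E) Γ V ρ
        ((Subtype.val '' A).indicator fun _ => 1) n ω) atTop
      (𝓝 (seriesMeasure α (m.real E) Γ V ρ E A ω)) :=
  h.ae_tendsto_seriesSum_cond hE0 hE1 hα0 hα2 le_rfl (memLp_indicator_image hE hE1 hA)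

theorem hasSymmetricStableCharFun_sum_seriesMeasure
    (h : IsSignedMarkedPoisson Γ V ρ (cond m E) P)
    (hE : NullMeasurableSet E m) (hE0 : m E ≠ 0) (hE1 : m E < ∞) (hα0 : 0 < α) (hα2 : α < 2)
    {ι : Type*} [Fintype ι] {A : ι → Set E} (hA : ∀ i, MeasurableSet (A i))
    (hd : Pairwise (Function.onFun Disjoint A)) (c : ι → ℝ) :
    HasSymmetricStableCharFun (fun ω => ∑ i, c i * seriesMeasure α (m.real E) Γ V ρ E (A i) ω) α
      (∑ i, |c i| ^ α * (m.comap Subtype.val).real (A i)) P := by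
  have := isFiniteMeasure_comap_val hE hE1
  rw [← integral_abs_sum_indicator_rpow hA hd c hα0.ne']
  refine (h.hasSymmetricStableCharFun_seriesSum_cond hE hE0 hE1 hα0 hα2 hα2 le_rfl
    (memLp_finsetSum _ fun i _ => (memLp_indicator_image hE hE1 (hA i)).const_mul (c i))).congr ?_
  filter_upwards [ae_all_iff.2 fun i => h.ae_tendsto_seriesMeasure hE hE0 hE1 hα0 hα2 (hA i)]
    with ω hω
  exact seriesSum_sum c fun i _ => hω i

theorem hasSymmetricStableCharFun_seriesMeasure
    (h : IsSignedMarkedPoisson Γ V ρ (cond m E) P)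
    (hE : NullMeasurableSet E m) (hE0 : m E ≠ 0) (hE1 : m E < ∞) (hα0 : 0 < α) (hα2 : α < 2)
    {A : Set E} (hA : MeasurableSet A) :
    HasSymmetricStableCharFun (seriesMeasure α (m.real E) Γ V ρ E A) α
      ((m.comap Subtype.val).real A) P := by
  have := h.hasSymmetricStableCharFun_sum_seriesMeasure hE hE0 hE1 hα0 hα2 (ι := Unit)
    (A := fun _ => A) (fun _ => hA) (fun i j hij => (hij rfl).elim) fun _ => 1
  simpa using this

/-- The joint characteristic function at `t` is that of `∑ t_i M(A_i)` at `1`. Its exponent is a sum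
over `i`, so it factorises into the marginals. -/
theorem iIndepFun_seriesMeasure_of_fintype (h : IsSignedMarkedPoisson Γ V ρ (cond m E) P)
    (hE : NullMeasurableSet E m) (hE0 : m E ≠ 0) (hE1 : m E < ∞) (hα0 : 0 < α) (hα2 : α < 2)
    {ι : Type*} [Fintype ι] {A : ι → Set E} (hA : ∀ i, MeasurableSet (A i))
    (hd : Pairwise (Function.onFun Disjoint A)) :
    iIndepFun (fun i => seriesMeasure α (m.real E) Γ V ρ E (A i)) P := by
  have hM := fun i => h.hasSymmetricStableCharFun_seriesMeasure hE hE0 hE1 hα0 hα2 (hA i)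
  have hMm : ∀ i, AEMeasurable (seriesMeasure α (m.real E) Γ V ρ E (A i)) P := fun i => (hM i).1
  refine (iIndepFun_iff_charFun_pi hMm).2 fun t => ?_
  have hsum := h.hasSymmetricStableCharFun_sum_seriesMeasure hE hE0 hE1 hα0 hα2 hA hd t.ofLp
  have h1 := hsum.2 1
  simp only [(hM _).2]
  have hexp : ∀ a : ι → ℝ, ∏ i, (Real.exp (-(a i)) : ℂ) = (Real.exp (-∑ i, a i) : ℂ) := by
    intro a
    rw [← Complex.ofReal_prod, ← Real.exp_sum, Finset.sum_neg_distrib]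
  rw [hexp]
  rw [abs_one, Real.one_rpow, one_mul] at h1
  rw [← h1, charFun_apply_real, charFun_apply,
    integral_map hsum.1 (by fun_prop : Measurable _).aestronglyMeasurable, integral_map
      (by fun_prop) (by fun_prop : Measurable _).aestronglyMeasurable]
  congr 1 with ω
  simp only [PiLp.inner_apply, RCLike.inner_apply, conj_trivial, Complex.ofReal_one, one_mul]

theorem iIndepFun_seriesMeasure (h : IsSignedMarkedPoisson Γ V ρ (cond m E) P)
    (hE : NullMeasurableSet E m) (hE0 : m E ≠ 0) (hE1 : m E < ∞) (hα0 : 0 < α) (hα2 : α < 2)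
    {ι : Type*} {A : ι → Set E} (hA : ∀ i, MeasurableSet (A i))
    (hd : Pairwise (Function.onFun Disjoint A)) :
    iIndepFun (fun i => seriesMeasure α (m.real E) Γ V ρ E (A i)) P := by
  rw [iIndepFun_iff_finset]
  intro s
  exact h.iIndepFun_seriesMeasure_of_fintype hE hE0 hE1 hα0 hα2
    (A := fun i : s => A i) (fun i => hA i) fun i j hij => hd (Subtype.coe_ne_coe.2 hij)

theorem seriesMeasure_sdiff (h : IsSignedMarkedPoisson Γ V ρ (cond m E) P)
    (hE : NullMeasurableSet E m) (hE0 : m E ≠ 0) (hE1 : m E < ∞) (hα0 : 0 < α) (hα2 : α < 2)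
    {A B : Set E} (hA : MeasurableSet A) (hB : MeasurableSet B) (hBA : B ⊆ A) :
    ∀ᵐ ω ∂P, seriesMeasure α (m.real E) Γ V ρ E (A \ B) ω =
      seriesMeasure α (m.real E) Γ V ρ E A ω - seriesMeasure α (m.real E) Γ V ρ E B ω := by
  filter_upwards [h.ae_tendsto_seriesMeasure hE hE0 hE1 hα0 hα2 hA,
    h.ae_tendsto_seriesMeasure hE hE0 hE1 hα0 hα2 hB] with ω h1 h2
  rw [seriesMeasure, indicator_image_val_diff hBA]
  exact seriesSum_sub h1 h2

theorem ae_sum_seriesMeasure_eq (h : IsSignedMarkedPoisson Γ V ρ (cond m E) P)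
    (hE : NullMeasurableSet E m) (hE0 : m E ≠ 0) (hE1 : m E < ∞) (hα0 : 0 < α) (hα2 : α < 2)
    {A : ℕ → Set E} (hA : ∀ j, MeasurableSet (A j))
    (hd : Pairwise (Function.onFun Disjoint A)) (n : ℕ) :
    ∀ᵐ ω ∂P, ∑ j ∈ Finset.range n, seriesMeasure α (m.real E) Γ V ρ E (A j) ω =
      seriesMeasure α (m.real E) Γ V ρ E (⋃ j ∈ Finset.range n, A j) ω := by
  have hB : ∀ n, MeasurableSet (⋃ j ∈ Finset.range n, A j) :=
    fun n => Finset.measurableSet_biUnion _ fun j _ => hA j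
  induction n with
  | zero =>
    -- Subtracting the empty set from itself gives `M(∅) = 0` almost surely.
    filter_upwards [h.seriesMeasure_sdiff hE hE0 hE1 hα0 hα2 MeasurableSet.empty
      MeasurableSet.empty subset_rfl] with ω hω
    rw [sdiff_self, Set.bot_eq_empty] at hω
    simp only [Finset.range_zero, Finset.sum_empty, Finset.notMem_empty, Set.iUnion_of_empty,
      Set.iUnion_empty]
    linarith
  | succ n ih =>
    have hU : ⋃ j ∈ Finset.range (n + 1), A j = A n ∪ ⋃ j ∈ Finset.range n, A j := by
      rw [Finset.range_add_one, Finset.set_biUnion_insert]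
    have hdis : (⋃ j ∈ Finset.range n, A j) = (⋃ j ∈ Finset.range (n + 1), A j) \ A n := by
      rw [hU, Set.union_sdiff_left, eq_comm, sdiff_eq_left]
      refine Set.disjoint_iUnion₂_left.2 fun j hj => hd ?_
      exact (Finset.mem_range.1 hj).ne
    filter_upwards [ih, h.seriesMeasure_sdiff hE hE0 hE1 hα0 hα2 (hB (n + 1)) (hA n)
      (hU ▸ Set.subset_union_left)] with ω h1 h2
    rw [← hdis] at h2
    rw [Finset.sum_range_succ, h1, h2]
    ring

/-- Independence and summability of the `|A_j|` give an almost sure limit. The remainder `M(⋃ A_j) -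
M(⋃_{j<n} A_j)` has the law attached to a set of vanishing measure, so it tends to `0` in
probability; an almost surely convergent subsequence identifies the limit. -/
theorem ae_tendsto_sum_seriesMeasure (h : IsSignedMarkedPoisson Γ V ρ (cond m E) P)
    (hE : NullMeasurableSet E m) (hE0 : m E ≠ 0) (hE1 : m E < ∞) (hα0 : 0 < α) (hα2 : α < 2)
    {A : ℕ → Set E} (hA : ∀ j, MeasurableSet (A j))
    (hd : Pairwise (Function.onFun Disjoint A)) :
    ∀ᵐ ω ∂P, Tendsto
      (fun n => ∑ j ∈ Finset.range n, seriesMeasure α (m.real E) Γ V ρ E (A j) ω) atTop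
      (𝓝 (seriesMeasure α (m.real E) Γ V ρ E (⋃ j, A j) ω)) := by
  have := isFiniteMeasure_comap_val hE hE1
  set μ : Measure E := m.comap Subtype.val
  have hB : ∀ n, MeasurableSet (⋃ j ∈ Finset.range n, A j) :=
    fun n => Finset.measurableSet_biUnion _ fun j _ => hA j
  have hBU : ∀ n, (⋃ j ∈ Finset.range n, A j) ⊆ ⋃ j, A j :=
    fun n => Set.iUnion₂_subset fun j _ => Set.subset_iUnion A j
  have hU := MeasurableSet.iUnion hA
  have hsum : HasSum (fun j => μ.real (A j)) (μ.real (⋃ j, A j)) := by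
    have h1 : ∑' j, μ (A j) ≠ ∞ := by
      rw [← measure_iUnion hd hA]
      exact measure_ne_top _ _
    have h2 := (ENNReal.summable_toReal h1).hasSum
    rw [← ENNReal.tsum_toReal_eq fun j => measure_ne_top _ _, ← measure_iUnion hd hA] at h2
    exact h2
  have hconv := ae_exists_tendsto_sum_of_hasSymmetricStableCharFun
    (fun j => h.hasSymmetricStableCharFun_seriesMeasure hE hE0 hE1 hα0 hα2 (hA j))
    (h.iIndepFun_seriesMeasure hE hE0 hE1 hα0 hα2 hA hd) hα0 (fun _ => measureReal_nonneg)
    hsum.summable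
  have hmeas : TendstoInMeasure P
      (fun n ω => ∑ j ∈ Finset.range n, seriesMeasure α (m.real E) Γ V ρ E (A j) ω) atTop
      (seriesMeasure α (m.real E) Γ V ρ E (⋃ j, A j)) := by
    refine tendstoInMeasure_of_hasSymmetricStableCharFun (α := α)
      (s := fun n => μ.real ((⋃ j, A j) \ ⋃ j ∈ Finset.range n, A j)) (fun n => ?_) hα0
      (fun _ => measureReal_nonneg) ?_
    · have hneg := (h.hasSymmetricStableCharFun_seriesMeasure hE hE0 hE1 hα0 hα2
        (hU.diff (hB n))).neg
      refine hneg.congr ?_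
      filter_upwards [h.ae_sum_seriesMeasure_eq hE hE0 hE1 hα0 hα2 hA hd n,
        h.seriesMeasure_sdiff hE hE0 hE1 hα0 hα2 hU (hB n) (hBU n)] with ω h1 h2
      rw [h1, h2]
      ring
    · have h1 : ∀ n, μ.real ((⋃ j, A j) \ ⋃ j ∈ Finset.range n, A j) =
          μ.real (⋃ j, A j) - ∑ j ∈ Finset.range n, μ.real (A j) := by
        intro n
        rw [measureReal_sdiff (hBU n) (hB n), measureReal_biUnion_finset
          (fun i _ j _ hij => hd hij) fun j _ => hA j]
      simp only [h1]
      simpa using hsum.tendsto_sum_nat.const_sub (μ.real (⋃ j, A j))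
  obtain ⟨ns, hns, hsub⟩ := hmeas.exists_seq_tendsto_ae
  filter_upwards [hconv, hsub] with ω ⟨l, hl⟩ h2
  rwa [tendsto_nhds_unique h2 (hl.comp hns.tendsto_atTop)]

theorem isSymmetricStableRandomMeasure (h : IsSignedMarkedPoisson Γ V ρ (cond m E) P)
    (hE : NullMeasurableSet E m) (hE0 : m E ≠ 0) (hE1 : m E < ∞) (hα0 : 0 < α) (hα2 : α < 2) :
    IsSymmetricStableRandomMeasure α (m.comap (Subtype.val : E → X)) P
      (seriesMeasure α (m.real E) Γ V ρ E) where
  measurable_skewness := measurable_const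
  abs_skewness_le := by simp
  hasStableLaw A hA _ := by
    simpa using (h.hasSymmetricStableCharFun_seriesMeasure hE hE0 hE1 hα0 hα2 hA).hasStableLaw
      hα0 measureReal_nonneg
  independentlyScattered _ _ hA _ hd := h.iIndepFun_seriesMeasure hE hE0 hE1 hα0 hα2 hA hd
  sigmaAdditive _ hA _ hd := h.ae_tendsto_sum_seriesMeasure hE hE0 hE1 hα0 hα2 hA hd

/-- By linearity `∫ g_k dM` minus the series for `f` is the series for `g_k - f`, whose scale is
governed by `∫ |g_k - f|^α`. Membership in `L^p` gives each difference its law, while convergence is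
needed only in `L^α`. -/
theorem isStochasticIntegral (h : IsSignedMarkedPoisson Γ V ρ (cond m E) P)
    (hE : NullMeasurableSet E m) (hE0 : m E ≠ 0) (hE1 : m E < ∞) (hα0 : 0 < α) (hα2 : α < 2)
    (hp : α < p) (hp2 : p ≤ 2) (hf : MemLp f (ENNReal.ofReal p) (m.restrict E)) :
    IsStochasticIntegral α (m.comap (Subtype.val : E → X)) P
      (seriesMeasure α (m.real E) Γ V ρ E) (fun x : E => f x)
      (seriesSum α (m.real E) Γ V ρ f) := by
  have := isFiniteMeasure_comap_val hE hE1
  have hfα : MemLp (fun x : E => f x) (ENNReal.ofReal α) (m.comap Subtype.val) :=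
    (memLp_comap_val hE hf).mono_exponent (ENNReal.ofReal_le_ofReal hp.le)
  refine ⟨hfα, (h.hasSymmetricStableCharFun_seriesSum_cond hE hE0 hE1 hα0 hα2 hp hp2 hf).1,
    fun g _ hg => ?_⟩
  -- The extension of `g k` by zero to the whole space, since the series takes functions on `X`.
  let φ : ℕ → X → ℝ := fun k x =>
    ∑ y ∈ (g k).range, y * (Subtype.val '' (g k ⁻¹' {y})).indicator (fun _ => 1) x
  have hφ : ∀ k (x : E), φ k x = g k x := fun k x => sum_range_mul_indicator (g k) x
  have hφp : ∀ k, MemLp (φ k) (ENNReal.ofReal p) (m.restrict E) := fun k =>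
    memLp_finsetSum _ fun y _ =>
      (memLp_indicator_image hE hE1 ((g k).measurableSet_fiber y)).const_mul y
  refine tendstoInMeasure_of_hasSymmetricStableCharFun (α := α)
    (s := fun k => ∫ x : E, |φ k x - f x| ^ α ∂(m.comap Subtype.val)) (fun k => ?_) hα0
    (fun k => integral_nonneg fun x => Real.rpow_nonneg (abs_nonneg _) _) ?_
  · refine (h.hasSymmetricStableCharFun_seriesSum_cond hE hE0 hE1 hα0 hα2 hp hp2
      ((hφp k).sub hf)).congr ?_
    have hpre : ∀ᵐ ω ∂P, ∀ y ∈ (g k).range, Tendsto (fun n => seriesPartialSum α (m.real E) Γ V ρ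
        ((Subtype.val '' (g k ⁻¹' {y})).indicator fun _ => 1) n ω) atTop
        (𝓝 (seriesMeasure α (m.real E) Γ V ρ E (g k ⁻¹' {y}) ω)) :=
      (ae_ball_iff (g k).range.countable_toSet).2 fun y _ =>
        h.ae_tendsto_seriesMeasure hE hE0 hE1 hα0 hα2 ((g k).measurableSet_fiber y)
    filter_upwards [h.ae_tendsto_seriesSum_cond hE0 hE1 hα0 hp hp2 hf,
      h.ae_tendsto_seriesSum_cond hE0 hE1 hα0 hp hp2 (hφp k), hpre] with ω h1 h2 h3
    refine (seriesSum_sub h2 h1).trans ?_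
    rw [simpleStochasticIntegral]
    exact congrArg (· - _) (seriesSum_sum (fun y => y) h3)
  · simp only [hφ]
    refine tendsto_integral_rpow_of_tendsto_eLpNorm hα0 (fun k => MemLp.sub ?_ hfα) hg
    exact ((g k).memLp_of_finite_measure_preimage _ fun y _ => measure_lt_top _ _)

end IsSignedMarkedPoisson

/-- On a set of finite measure `L^p ⊆ L^q` for `q ≤ p`, so a finite exponent in `(α, 2]` suffices:
`1` when `α < 1`, and `min p 2` otherwise. -/
theorem exists_real_exponent {α : ℝ} (hα0 : 0 < α) (hα2 : α < 2) {p : ℝ≥0∞}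
    (h1 : α < 1 → 1 ≤ p) (h2 : 1 ≤ α → ENNReal.ofReal α < p) :
    ∃ q : ℝ, α < q ∧ q ≤ 2 ∧ ENNReal.ofReal q ≤ p := by
  rcases lt_or_ge α 1 with hα | hα
  · exact ⟨1, hα, one_le_two, by simpa using h1 hα⟩
  · have hmin : min p 2 ≠ ∞ := ne_top_of_le_ne_top ENNReal.ofNat_ne_top (min_le_right p 2)
    refine ⟨(min p 2).toReal, ?_, ?_, ?_⟩
    · rw [← ENNReal.ofReal_lt_iff_lt_toReal hα0.le hmin]
      refine lt_min (h2 hα) ?_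
      simpa using (ENNReal.ofReal_lt_ofReal_iff two_pos).2 hα2
    · simpa using ENNReal.toReal_mono ENNReal.ofNat_ne_top (min_le_right p 2)
    · rw [ENNReal.ofReal_toReal hmin]
      exact min_le_left _ _

end

theorem mainTheorem8 {Ω : Type*} [MeasurableSpace Ω] (P : Measure Ω) [IsProbabilityMeasure P]
    (d : ℕ) (α : ℝ) (hα0 : 0 < α) (hα2 : α < 2)
    (E : Set (EuclideanSpace ℝ (Fin d))) (hE : NullMeasurableSet E volume)
    (hE0 : 0 < volume E) (hE1 : volume E < ∞)
    (Γ : ℕ → Ω → ℝ) (V : ℕ → Ω → EuclideanSpace ℝ (Fin d)) (ρ : ℕ → Ω → ℝ)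
    (hΓ : IsPoissonArrivalTimes Γ P)
    (hVρ : iIndepFun (fun k ω => (V k ω, ρ k ω)) P)
    (hVρ_law : ∀ k, HasLaw (fun ω => (V k ω, ρ k ω))
      ((ProbabilityTheory.cond volume E).prod fairSign) P)
    (hΓVρ : IndepFun (fun ω k => Γ k ω) (fun ω k => (V k ω, ρ k ω)) P) :
    -- the improper integral defining the constant converges, to a positive number
    (Tendsto (sineIntegral α) atTop (𝓝 (stableConst α)⁻¹) ∧ 0 < stableConst α) ∧
    -- the series for `M(A)` converges almost surely
    (∀ A : Set E, MeasurableSet A → ∀ᵐ ω ∂P,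
      Tendsto (fun n => seriesPartialSum α (volume.real E) Γ V ρ
          ((Subtype.val '' A).indicator fun _ => 1) n ω) atTop
        (𝓝 (seriesMeasure α (volume.real E) Γ V ρ E A ω))) ∧
    -- it defines a symmetric stable random measure controlled by Lebesgue measure on `E`
    IsSymmetricStableRandomMeasure α (Measure.comap (Subtype.val : E → _) volume) P
      (seriesMeasure α (volume.real E) Γ V ρ E) ∧
    -- the series for `f` converges almost surely to the stochastic integral of `f`
    (∀ (p : ℝ≥0∞) (f : EuclideanSpace ℝ (Fin d) → ℝ),
      (α < 1 → 1 ≤ p) → (1 ≤ α → ENNReal.ofReal α < p) → MemLp f p (volume.restrict E) →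
        (∀ᵐ ω ∂P, Tendsto (fun n => seriesPartialSum α (volume.real E) Γ V ρ f n ω) atTop
          (𝓝 (seriesSum α (volume.real E) Γ V ρ f ω))) ∧
        IsStochasticIntegral α (Measure.comap (Subtype.val : E → _) volume) P
          (seriesMeasure α (volume.real E) Γ V ρ E) (fun x : E => f x)
          (seriesSum α (volume.real E) Γ V ρ f)) := by
  have hE0' := hE0.ne'
  have h : IsSignedMarkedPoisson Γ V ρ (ProbabilityTheory.cond volume E) P :=
    ⟨hΓ, hVρ, hVρ_law, hΓVρ⟩
  have : IsFiniteMeasure (volume.restrict E) := ⟨by simpa using hE1⟩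
  refine ⟨⟨?_, ?_⟩, fun A hA => h.ae_tendsto_seriesMeasure hE hE0' hE1 hα0 hα2 hA,
    h.isSymmetricStableRandomMeasure hE hE0' hE1 hα0 hα2, fun p f hp1 hp2 hf => ?_⟩
  · rw [stableConst_eq hα0 hα2, inv_inv]
    exact tendsto_sineIntegral hα0 hα2
  · rw [stableConst_eq hα0 hα2]
    exact inv_pos.2 (stableIntegral_pos hα0 hα2)
  · obtain ⟨q, hαq, hq2, hqp⟩ := exists_real_exponent hα0 hα2 hp1 hp2
    have hfq := hf.mono_exponent hqp
    exact ⟨h.ae_tendsto_seriesSum_cond hE0' hE1 hα0 hαq hq2 hfq,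
      h.isStochasticIntegral hE hE0' hE1 hα0 hα2 hαq hq2 hfq⟩
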